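/- **Theorem (Training with perfectly clustered data).** *Data.* Let $0<c_{low}<c_{up}$ and $n,K\ge 1$. Let $x_1,\dots,x_n\in\mathbb{R}^d$ be unit vectors, each equal to the center of its cluster among $K$ unit-norm cluster centers $c_1,\dots,c_K\in\mathbb{R}^d$ (input noise level $\varepsilon_0=0$), where the $\ell$-th cluster contains $n_\ell$ samples and $c_{low}\frac nK\le n_\ell\le c_{up}\frac nK$. Every cluster belongs to one of $\bar K\le K$ classes with labels $\alpha_1,\dots,\alpha_{\bar K}\in[-1,1]$ satisfying $|\alpha_r-\alpha_s|\ge\delta$ for $r\ne s$, where $\delta>0$; the ground-truth label $\widetilde y_i$ is the label of the class of the cluster of $x_i$. The observed labels $y_i\in\{\alpha_1,\dots,\alpha_{\bar K}\}$ satisfy, for each $\ell$, $y_i\neq\widetilde y_i$ for at most $\rho n_\ell$ of the samples of the $\ell$-th cluster, where $0<\rho\le 1$. *Network.* Let $\phi:\mathbb{R}\to\mathbb{R}$ be twice differentiable with $|\phi(0)|,|\phi'(z)|,|\phi''(z)|\le\Gamma$ for all $z$, where $\Gamma\ge1$. Let $f(W,x)=v^T\phi(Wx)$ with $W\in\mathbb{R}^{k\times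 d}$ and fixed $v\in\mathbb{R}^k$, where $\phi$ acts entrywise, half of the entries of $v$ are $1/\sqrt k$ and the other half $-1/\sqrt k$ (if $k$ is odd, one entry is $0$ and the others are split equally). Let $C\in\mathbb{R}^{K\times d}$ have rows $c_1,\dots,c_K$, let $\|C\|$ be its spectral norm, and let $\lambda(C)$ be the minimum eigenvalue of $\Sigma(C)=(CC^T)\odot\mathbb{E}_{g\sim\mathcal N(0,I_d)}[\phi'(Cg)\phi'(Cg)^T]$, with $\odot$ the entrywise product. Assume $\lambda(C)>0$. *Training.* Let $W_0\in\mathbb{R}^{k\times d}$ have i.i.d. $\mathcal N(0,1)$ entries and run gradient descent $W_{\tau+1}=W_\tau-\eta\nabla\mathcal L(W_\tau)$ on $\mathcal L(W)=\frac12\sum_{i=1}^n(y_i-f(W,x_i))^2$ with $0<\eta\le\frac{K}{2c_{up}n\Gamma^2\|C\|^2}$. *Conclusion.* There are constants $\mathbf C,c>0$ depending only on $c_{low},c_{up}$ such that, whenever $$k\ \ge\ \mathbf C\,\Gamma^4\,\frac{K\log(K)\,\|C\|^2}{\lambda(C)^2},$$ with probability at least $1-2/K^{100}$ over $W_0$ the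 following hold simultaneously. 1. For all $\tau\ge0$, $\ \|W_\tau-W_0\|_F\le c\,\Gamma\sqrt{\frac{K\log K}{\lambda(C)}}$. 2. For all $\tau\ge\tau_0:=c\,\frac{K}{\eta n\lambda(C)}\log\Big(\frac{\Gamma\sqrt{n\log K}}{\rho}\Big)$ and all $1\le i\le n$, $\ |f(W_\tau,x_i)-\widetilde y_i|\le4\rho$. If moreover $\rho\le\delta/8$, then for all such $\tau$ and all $i$, $\widetilde y_i$ is the unique minimizer of $|f(W_\tau,x_i)-\alpha|$ over $\alpha\in\{\alpha_1,\dots,\alpha_{\bar K}\}$, so every sample, including the corrupted ones, is classified correctly. -/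

import Mathlib

open MeasureTheory ProbabilityTheory

/-- An `(ε₀, δ)`-clusterable dataset with `n` inputs in `ℝᵈ`, `K` clusters and `Kbar` classes,
balanced with constants `clow` and `cup`. -/
structure ClusterableDataset (n d K Kbar : ℕ) (clow cup ε₀ δ : ℝ) where
  /-- the inputs -/
  x : Fin n → EuclideanSpace ℝ (Fin d)
  /-- the cluster from which each input originates -/
  cluster : Fin n → Fin K
  /-- the cluster centers -/
  center : Fin K → EuclideanSpace ℝ (Fin d)
  /-- the class labels -/
  α : Fin Kbar → ℝ
  /-- the class to which each cluster belongs -/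
  cls : Fin K → Fin Kbar
  classes_le : Kbar ≤ K
  norm_x : ∀ i, ‖x i‖ = 1
  norm_center : ∀ l, ‖center l‖ = 1
  dist_center : ∀ i, ‖x i - center (cluster i)‖ ≤ ε₀
  balanced_low : ∀ l : Fin K,
    clow * (n / K) ≤ ((Finset.univ.filter fun i => cluster i = l).card : ℝ)
  balanced_up : ∀ l : Fin K,
    ((Finset.univ.filter fun i => cluster i = l).card : ℝ) ≤ cup * (n / K)
  label_mem : ∀ r, α r ∈ Set.Icc (-1 : ℝ) 1
  label_sep : ∀ r s, r ≠ s → δ ≤ |α r - α s|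
  center_sep : ∀ l l', cls l ≠ cls l' → 2 * ε₀ ≤ ‖center l - center l'‖

/-- The ground truth label of the `i`-th sample: the label of the class of its cluster. -/
def ClusterableDataset.truth {n d K Kbar : ℕ} {clow cup ε₀ δ : ℝ}
    (D : ClusterableDataset n d K Kbar clow cup ε₀ δ) (i : Fin n) : ℝ :=
  D.α (D.cls (D.cluster i))

/-- The matrix `C ∈ ℝ^{K × d}` whose rows are the cluster centers. -/
def ClusterableDataset.centerMatrix {n d K Kbar : ℕ} {clow cup ε₀ δ : ℝ}
    (D : ClusterableDataset n d K Kbar clow cup ε₀ δ) : Matrix (Fin K) (Fin d) ℝ :=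
  Matrix.of fun l a => D.center l a

/-- A `(ρ, ε₀, δ)`-corrupted dataset: a clusterable dataset with observed labels `y`, which take
values among the class labels and which, within each cluster, differ from the ground truth for at
most a fraction `ρ` of the samples. -/
structure CorruptedDataset (n d K Kbar : ℕ) (clow cup ρ ε₀ δ : ℝ) extends
    ClusterableDataset n d K Kbar clow cup ε₀ δ where
  /-- the observed labels -/
  y : Fin n → ℝ
  y_mem : ∀ i, y i ∈ Set.range α
  corrupted_le : ∀ l : Fin K,
    ((Finset.univ.filter fun i => cluster i = l ∧ y i ≠ toClusterableDataset.truth i).card : ℝ)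
      ≤ ρ * ((Finset.univ.filter fun i => cluster i = l).card : ℝ)

/-- `φ` is twice differentiable with `|φ(0)|, |φ'(z)|, |φ''(z)| ≤ Γ` for all `z`. -/
structure IsBoundedActivation (φ : ℝ → ℝ) (Γ : ℝ) : Prop where
  differentiable : Differentiable ℝ φ
  differentiable_deriv : Differentiable ℝ (deriv φ)
  zero_le : |φ 0| ≤ Γ
  deriv_le : ∀ z, |deriv φ z| ≤ Γ
  deriv_deriv_le : ∀ z, |deriv (deriv φ) z| ≤ Γ

/-- Half of the entries of `v` are `1/√k` and the other half `-1/√k`; if `k` is odd, the one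
remaining entry is `0`. -/
structure IsBalancedOutput {k : ℕ} (v : Fin k → ℝ) : Prop where
  entries : ∀ j, v j = 1 / Real.sqrt k ∨ v j = -(1 / Real.sqrt k) ∨ v j = 0
  card_pos : (Finset.univ.filter fun j => v j = 1 / Real.sqrt k).card = k / 2
  card_neg : (Finset.univ.filter fun j => v j = -(1 / Real.sqrt k)).card = k / 2

/-- `k × d` weight matrices. The Euclidean norm on the entries is the Frobenius norm. -/
abbrev Weights (k d : ℕ) : Type := EuclideanSpace ℝ (Fin k × Fin d)

/-- The network `f(W, x) = vᵀ φ(W x)`. -/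
noncomputable def network {k d : ℕ} (φ : ℝ → ℝ) (v : Fin k → ℝ) (W : Weights k d)
    (x : EuclideanSpace ℝ (Fin d)) : ℝ :=
  ∑ j, v j * φ (∑ a, W (j, a) * x a)

/-- The least-squares loss `L(W) = ½ ∑ᵢ (yᵢ - f(W, xᵢ))²`. -/
noncomputable def loss {n k d : ℕ} (φ : ℝ → ℝ) (v : Fin k → ℝ)
    (x : Fin n → EuclideanSpace ℝ (Fin d)) (y : Fin n → ℝ) (W : Weights k d) : ℝ :=
  1 / 2 * ∑ i, (y i - network φ v W (x i)) ^ 2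

/-- The gradient descent iterates `W_{τ+1} = W_τ - η ∇L(W_τ)` started from `W₀`. -/
noncomputable def gdIterate {n k d : ℕ} (φ : ℝ → ℝ) (v : Fin k → ℝ)
    (x : Fin n → EuclideanSpace ℝ (Fin d)) (y : Fin n → ℝ) (η : ℝ) (W₀ : Weights k d) :
    ℕ → Weights k d
  | 0 => W₀
  | τ + 1 => gdIterate φ v x y η W₀ τ - η • gradient (loss φ v x y) (gdIterate φ v x y η W₀ τ)

/-- The law of a vector indexed by `ι` with i.i.d. `N(0, 1)` entries. -/
noncomputable def stdNormal (ι : Type) [Fintype ι] : Measure (EuclideanSpace ℝ ι) :=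
  (Measure.pi fun _ : ι => gaussianReal 0 1).map (WithLp.toLp 2)

/-- The neural net covariance `Σ(C) = (C Cᵀ) ⊙ E_g[φ'(C g) φ'(C g)ᵀ]` with `g ∼ N(0, I_d)`. -/
noncomputable def netCov {K d : ℕ} (φ : ℝ → ℝ) (C : Matrix (Fin K) (Fin d) ℝ) :
    Matrix (Fin K) (Fin K) ℝ :=
  Matrix.hadamard (C * C.transpose) (Matrix.of fun l l' =>
    ∫ g : EuclideanSpace ℝ (Fin d),
      deriv φ (∑ a, C l a * g a) * deriv φ (∑ a, C l' a * g a) ∂stdNormal (Fin d))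

theorem netCov_isHermitian {K d : ℕ} (φ : ℝ → ℝ) (C : Matrix (Fin K) (Fin d) ℝ) :
    (netCov φ C).IsHermitian := by
  ext l l'
  simp [netCov, Matrix.hadamard, Matrix.mul_apply, mul_comm]

/-- `λ(C)`: the minimum eigenvalue of `Σ(C)`. -/
noncomputable def minEigCov {K d : ℕ} (φ : ℝ → ℝ) (C : Matrix (Fin K) (Fin d) ℝ) : ℝ :=
  ⨅ l, (netCov_isHermitian φ C).eigenvalues l

/-- The spectral norm of a matrix (its largest singular value). -/
noncomputable def specNorm {m n : ℕ} (A : Matrix (Fin m) (Fin n) ℝ) : ℝ :=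
  ‖(Matrix.toEuclideanLin A).toContinuousLinearMap‖

/-- The set of minimizers of `a ↦ |t - a|` over the class labels. -/
def argminLabel {Kbar : ℕ} (α : Fin Kbar → ℝ) (t : ℝ) : Set ℝ :=
  {a | a ∈ Set.range α ∧ ∀ b ∈ Set.range α, |t - a| ≤ |t - b|}

/-! The inputs of a cluster coincide, so its labels enter the gradient of the loss only through
their mean (`CorruptedDataset.gradient_loss`). Training is therefore gradient descent for a
least-squares problem with only `K` residuals, `√n_l * (f(W, c_l) - mean_l)`. Corruption merely
shifts the means: at most `ρ n_l` labels of a cluster are wrong, each by at most 2, so the mean is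
within `2ρ` of the truth. Once the residuals are at most `ρ`, every prediction is within `3ρ` of the
truth.

It remains to solve the reduced problem near the initialization and at a linear rate.
`gradientDescent_converges` does this for any map whose Jacobian has norm at most `β`, is
`L`-Lipschitz, and has adjoint bounded below by `a` at the start, provided that the initial residual
is at most `R` with `8 L R ≤ a²`: the iterates then never leave the region where the Jacobian stays
well conditioned. Here `β² = cup (n/K) Γ² ‖C‖²`, while `L = β/√k`, so a large width enforces the
smallness condition.

Randomness enters through `W₀` in two ways (`le_measure_initialization`). First, up to the weights
`√n_l`, the Gram matrix of the Jacobian at `W₀` is `(C Cᵀ) ⊙ ∑_j v_j² φ'(C w_j) φ'(C w_j)ᵀ`, whose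
mean is `(∑ v_j²) Σ(C)`. Entrywise Hoeffding bounds suffice for its least eigenvalue because the
Frobenius norm of `C Cᵀ` is at most `√K ‖C‖`. Second, the initial outputs are of order `Γ √(log K)`,
since the balanced signs of `v` cancel the mean of `φ` and Lipschitz functions of a Gaussian are
sub-Gaussian. -/

/-! ### Gradient descent for nonlinear least squares -/

open ContinuousLinearMap in
theorem norm_image_sub_sub_adjoint_le {E H : Type*}
    [NormedAddCommGroup E] [InnerProductSpace ℝ E] [CompleteSpace E]
    [NormedAddCommGroup H] [InnerProductSpace ℝ H] [CompleteSpace H]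
    {F : E → H} {G : E → H →L[ℝ] E} {L : ℝ} (hL : 0 ≤ L)
    (hF : ∀ W, HasFDerivAt F (adjoint (G W)) W)
    (hGL : ∀ W W', ‖G W - G W'‖ ≤ L * ‖W - W'‖) (W h : E) :
    ‖F (W + h) - F W - adjoint (G W) h‖ ≤ L * ‖h‖ ^ 2 := by
  -- On the ball of radius `‖h‖` about `W` the derivative varies by at most `L ‖h‖`, so the mean
  -- value inequality gives `L ‖h‖²`; the sharper factor 1/2 is not needed.
  have key := (convex_closedBall W ‖h‖).norm_image_sub_le_of_norm_hasFDerivWithin_le'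
    (f := F) (φ := adjoint (G W)) (C := L * ‖h‖) (x := W) (y := W + h)
    (fun x _ => (hF x).hasFDerivWithinAt)
    (fun x hx => by
      rw [← map_sub, LinearIsometryEquiv.norm_map]
      refine (hGL x W).trans ?_
      gcongr
      simpa [dist_eq_norm] using hx)
    (by simp) (by simp)
  simp only [add_sub_cancel_left] at key
  calc _ ≤ _ := key
    _ = _ := by ring

open ContinuousLinearMap in
/-- One step of gradient descent on `½‖F W - y‖²` decreases the residual in proportion to the
squared norm of the gradient. -/
theorem norm_residual_step_le {E H : Type*}
    [NormedAddCommGroup E] [InnerProductSpace ℝ E] [CompleteSpace E]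
    [NormedAddCommGroup H] [InnerProductSpace ℝ H] [CompleteSpace H]
    {F : E → H} {G : E → H →L[ℝ] E} {L β η : ℝ} (hL : 0 ≤ L) (hη : 0 ≤ η)
    (hF : ∀ W, HasFDerivAt F (adjoint (G W)) W)
    (hGL : ∀ W W', ‖G W - G W'‖ ≤ L * ‖W - W'‖)
    (y : H) (W : E) (hGβ : ‖G W‖ ≤ β) (hηβ : η * β ^ 2 ≤ 1 / 2)
    (hsmall : η * L * ‖F W - y‖ ≤ 1 / 4) :
    ‖F W - y‖ * ‖F (W - η • G W (F W - y)) - y‖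
      ≤ ‖F W - y‖ ^ 2 - 1 / 2 * η * ‖G W (F W - y)‖ ^ 2 := by
  set r := F W - y with hr
  set g := G W r with hg
  set M := adjoint (G W) g with hM
  have htay := norm_image_sub_sub_adjoint_le hL hF hGL W (-(η • g))
  rw [norm_neg, norm_smul, Real.norm_of_nonneg hη, map_neg, map_smul, ← hM] at htay
  have hMle : ‖M‖ ≤ β * ‖g‖ := by
    refine (le_opNorm _ _).trans ?_
    rw [LinearIsometryEquiv.norm_map]
    gcongr
  have hinner : inner ℝ r M = ‖g‖ ^ 2 := by
    rw [hM, adjoint_inner_right, ← hg, real_inner_self_eq_norm_sq]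
  have hsq : ‖r - η • M‖ ^ 2 ≤ ‖r‖ ^ 2 - 3 / 2 * η * ‖g‖ ^ 2 := by
    rw [norm_sub_sq_real, inner_smul_right, hinner, norm_smul, Real.norm_of_nonneg hη]
    have h1 : ‖M‖ ^ 2 ≤ (β * ‖g‖) ^ 2 := by gcongr
    have h2 : η ^ 2 * ‖M‖ ^ 2 ≤ η * (η * β ^ 2) * ‖g‖ ^ 2 := by
      calc _ ≤ η ^ 2 * (β * ‖g‖) ^ 2 := by gcongr
        _ = _ := by ring
    have h3 : η * (η * β ^ 2) * ‖g‖ ^ 2 ≤ η * (1 / 2) * ‖g‖ ^ 2 := by gcongr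
    nlinarith
  -- AM-GM turns the bound on the square into one on the product with `‖r‖`; this form needs no
  -- square root and no division by a possibly zero residual.
  have h4 : ‖r‖ * ‖r - η • M‖ ≤ ‖r‖ ^ 2 - 3 / 4 * η * ‖g‖ ^ 2 := by
    nlinarith [sq_nonneg (‖r‖ - ‖r - η • M‖)]
  have h5 : ‖F (W - η • g) - y‖ ≤ ‖r - η • M‖ + L * (η * ‖g‖) ^ 2 := by
    have : F (W - η • g) - y = (r - η • M) + (F (W + -(η • g)) - F W - -(η • M)) := by
      rw [hr, ← sub_eq_add_neg]; abel
    rw [this]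
    exact (norm_add_le _ _).trans (by gcongr)
  -- The curvature term uses up 1/4 of the 3/4 gained by the linearized step, which leaves 1/2.
  have h6 : ‖r‖ * (L * (η * ‖g‖) ^ 2) ≤ 1 / 4 * (η * ‖g‖ ^ 2) := by
    calc _ = (η * L * ‖r‖) * (η * ‖g‖ ^ 2) := by ring
      _ ≤ _ := by gcongr
  nlinarith [mul_le_mul_of_nonneg_left h5 (norm_nonneg r)]

open ContinuousLinearMap in
/-- Gradient descent on `½‖F W - y‖²` stays close to its starting point and converges linearly,
if the Jacobian is well conditioned at the starting point and varies slowly. -/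
theorem gradientDescent_converges {E H : Type*}
    [NormedAddCommGroup E] [InnerProductSpace ℝ E] [CompleteSpace E]
    [NormedAddCommGroup H] [InnerProductSpace ℝ H] [CompleteSpace H]
    {F : E → H} {G : E → H →L[ℝ] E} {L β η a R : ℝ} (hL : 0 ≤ L) (hη : 0 ≤ η)
    (ha : 0 < a) (haβ : a ≤ β)
    (hF : ∀ W, HasFDerivAt F (adjoint (G W)) W)
    (hGL : ∀ W W', ‖G W - G W'‖ ≤ L * ‖W - W'‖)
    (hGβ : ∀ W, ‖G W‖ ≤ β) (hηβ : η * β ^ 2 ≤ 1 / 2) (y : H) (W : ℕ → E)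
    (hstep : ∀ τ, W (τ + 1) = W τ - η • G (W τ) (F (W τ) - y))
    (hlow : ∀ r, a * ‖r‖ ≤ ‖G (W 0) r‖)
    (hR : ‖F (W 0) - y‖ ≤ R) (hsmall : 8 * L * R ≤ a ^ 2) (τ : ℕ) :
    ‖W τ - W 0‖ ≤ 4 * R / a ∧ ‖F (W τ) - y‖ ≤ (1 - η * a ^ 2 / 8) ^ τ * R := by
  have hR0 : 0 ≤ R := (norm_nonneg _).trans hR
  have hηa : η * a ^ 2 ≤ 1 / 2 := le_trans (by gcongr) hηβ
  -- The sum of distance and `4/a` times residual is a Lyapunov function: each step lowers the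
  -- residual by at least `a/4` times its length.
  suffices h : ‖W τ - W 0‖ + 4 / a * ‖F (W τ) - y‖ ≤ 4 / a * R ∧
      ‖F (W τ) - y‖ ≤ (1 - η * a ^ 2 / 8) ^ τ * R by
    refine ⟨?_, h.2⟩
    have : 0 ≤ 4 / a * ‖F (W τ) - y‖ := by positivity
    calc _ ≤ 4 / a * R := by linarith [h.1]
      _ = _ := by ring
  induction τ with
  | zero => simpa using ⟨by gcongr, hR⟩
  | succ τ ih =>
    obtain ⟨ih1, ih2⟩ := ih
    set r := F (W τ) - y with hr
    set g := G (W τ) r with hg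
    have hrR : ‖r‖ ≤ R := by
      have : 4 / a * ‖r‖ ≤ 4 / a * R := by linarith [norm_nonneg (W τ - W 0)]
      exact le_of_mul_le_mul_left this (by positivity)
    have hdist : ‖W τ - W 0‖ ≤ 4 / a * R := by
      have : 0 ≤ 4 / a * ‖r‖ := by positivity
      linarith
    -- Within distance `4R/a` of the start the Jacobian moves by at most `4LR/a ≤ a/2`, so half of
    -- the lower bound `a` survives.
    have hglow : a / 2 * ‖r‖ ≤ ‖g‖ := by
      have h1 : ‖(G (W τ) - G (W 0)) r‖ ≤ a / 2 * ‖r‖ := by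
        refine ContinuousLinearMap.le_of_opNorm_le _ ((hGL _ _).trans ?_) r
        calc L * ‖W τ - W 0‖ ≤ L * (4 / a * R) := by gcongr
          _ = (8 * L * R) / (2 * a) := by field_simp; ring
          _ ≤ a ^ 2 / (2 * a) := by gcongr
          _ = a / 2 := by field_simp
      have h2 : ‖G (W 0) r‖ ≤ ‖g‖ + ‖(G (W τ) - G (W 0)) r‖ := by
        have : G (W 0) r = g - (G (W τ) - G (W 0)) r := by simp [hg]
        rw [this]
        exact norm_sub_le _ _
      linarith [hlow r]
    have hst := norm_residual_step_le hL hη hF hGL y (W τ) (hGβ _) hηβ (by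
      calc η * L * ‖r‖ ≤ η * L * R := by gcongr
        _ = η * (8 * L * R) / 8 := by ring
        _ ≤ η * a ^ 2 / 8 := by gcongr
        _ ≤ 1 / 4 := by linarith)
    rw [← hstep, ← hr, ← hg] at hst
    have hmove : ‖W (τ + 1) - W 0‖ ≤ ‖W τ - W 0‖ + η * ‖g‖ := by
      have : W (τ + 1) - W 0 = (W τ - W 0) - η • g := by rw [hstep]; abel
      rw [this]
      refine (norm_sub_le _ _).trans ?_
      rw [norm_smul, Real.norm_of_nonneg hη]
    -- Replacing one factor `‖g‖` of the decrease by `a/2 * ‖r‖` pays for the step length; replacing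
    -- both gives the linear rate.
    have hboth : ‖F (W (τ + 1)) - y‖ ≤ ‖r‖ - a / 4 * (η * ‖g‖) ∧
        ‖F (W (τ + 1)) - y‖ ≤ (1 - η * a ^ 2 / 8) * ‖r‖ := by
      rcases (norm_nonneg r).eq_or_lt with h0 | hpos
      · have hr0 : r = 0 := norm_eq_zero.1 h0.symm
        have hg0 : g = 0 := by rw [hg, hr0, map_zero]
        have hW : W (τ + 1) = W τ := by rw [hstep, ← hr, ← hg, hg0]; simp
        rw [hW, ← hr, hg0, hr0]
        simp
      · have hηg : 0 ≤ η * ‖g‖ := by positivity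
        constructor
        · refine le_of_mul_le_mul_left (hst.trans ?_) hpos
          nlinarith [mul_le_mul_of_nonneg_left hglow hηg]
        · refine le_of_mul_le_mul_left (hst.trans ?_) hpos
          have : η * (a / 2 * ‖r‖) ^ 2 ≤ η * ‖g‖ ^ 2 := by gcongr
          nlinarith
    constructor
    · have h1 : 4 / a * ‖F (W (τ + 1)) - y‖ ≤ 4 / a * (‖r‖ - a / 4 * (η * ‖g‖)) := by
        gcongr
        exact hboth.1
      have h2 : 4 / a * (‖r‖ - a / 4 * (η * ‖g‖)) = 4 / a * ‖r‖ - η * ‖g‖ := by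
        field_simp
      linarith
    · calc _ ≤ _ := hboth.2
        _ ≤ (1 - η * a ^ 2 / 8) * ((1 - η * a ^ 2 / 8) ^ τ * R) := by
          have : 0 ≤ 1 - η * a ^ 2 / 8 := by linarith
          gcongr
        _ = _ := by ring

/-! ### The network, its gradient and bounds on the Jacobian -/

theorem norm_toEuclideanLin_le {m n : ℕ} (A : Matrix (Fin m) (Fin n) ℝ)
    (u : EuclideanSpace ℝ (Fin n)) :
    ‖Matrix.toEuclideanLin A u‖ ≤ specNorm A * ‖u‖ :=
  (Matrix.toEuclideanLin A).toContinuousLinearMap.le_opNorm u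

theorem specNorm_nonneg {m n : ℕ} (A : Matrix (Fin m) (Fin n) ℝ) : 0 ≤ specNorm A :=
  norm_nonneg _

/-- The transpose of a matrix is bounded by the spectral norm. -/
theorem sum_sq_sum_mul_le {m n : ℕ} (A : Matrix (Fin m) (Fin n) ℝ) (z : Fin m → ℝ) :
    ∑ a, (∑ l, z l * A l a) ^ 2 ≤ specNorm A ^ 2 * ∑ l, z l ^ 2 := by
  set u : EuclideanSpace ℝ (Fin n) := WithLp.toLp 2 (fun a => ∑ l, z l * A l a) with hu
  set z' : EuclideanSpace ℝ (Fin m) := WithLp.toLp 2 z with hz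
  have h1 : ‖u‖ ^ 2 = inner ℝ z' (Matrix.toEuclideanLin A u) := by
    rw [EuclideanSpace.real_norm_sq_eq, PiLp.inner_apply]
    simp only [hu, hz, Matrix.toLpLin_apply, Matrix.mulVec, dotProduct, RCLike.inner_apply,
      conj_trivial, sq, Finset.sum_mul, Finset.mul_sum]
    rw [Finset.sum_comm]
    refine Finset.sum_congr rfl fun l _ => Finset.sum_congr rfl fun a _ => ?_
    refine Finset.sum_congr rfl fun l' _ => ?_
    ring
  have h2 : ‖u‖ ^ 2 ≤ ‖z'‖ * (specNorm A * ‖u‖) := by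
    rw [h1]
    exact (real_inner_le_norm _ _).trans
      (mul_le_mul_of_nonneg_left (norm_toEuclideanLin_le A u) (norm_nonneg _))
  have h3 : ‖u‖ ≤ specNorm A * ‖z'‖ := by
    rcases (norm_nonneg u).eq_or_lt with h | h
    · rw [← h]; exact mul_nonneg (specNorm_nonneg A) (norm_nonneg _)
    · nlinarith
  calc _ = ‖u‖ ^ 2 := by rw [EuclideanSpace.real_norm_sq_eq]
    _ ≤ (specNorm A * ‖z'‖) ^ 2 := by gcongr
    _ = _ := by rw [mul_pow, EuclideanSpace.real_norm_sq_eq]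

/-- The gradient of `W ↦ f(W, x)`. -/
noncomputable def netGrad {k d : ℕ} (φ : ℝ → ℝ) (v : Fin k → ℝ) (W : Weights k d)
    (x : EuclideanSpace ℝ (Fin d)) : Weights k d :=
  WithLp.toLp 2 fun p => v p.1 * deriv φ (∑ a, W (p.1, a) * x a) * x p.2

theorem hasFDerivAt_network {k d : ℕ} {φ : ℝ → ℝ} (hφ : Differentiable ℝ φ) (v : Fin k → ℝ)
    (x : EuclideanSpace ℝ (Fin d)) (W : Weights k d) :
    HasFDerivAt (fun W => network φ v W x) (innerSL ℝ (netGrad φ v W x)) W := by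
  have hlin : ∀ j, HasFDerivAt (fun W : Weights k d => ∑ a, W (j, a) * x a)
      (∑ a, x a • (EuclideanSpace.proj (j, a) : Weights k d →L[ℝ] ℝ)) W := fun j => by
    refine HasFDerivAt.fun_sum fun a _ => ?_
    exact ((EuclideanSpace.proj (j, a) : Weights k d →L[ℝ] ℝ).hasFDerivAt).mul_const (x a)
  have h := HasFDerivAt.fun_sum (u := Finset.univ) fun j _ =>
    (((hφ _).hasDerivAt.comp_hasFDerivAt W (hlin j)).const_mul (v j))
  refine h.congr_fderiv ?_
  ext U
  simp only [innerSL_apply_apply, PiLp.inner_apply, netGrad, RCLike.inner_apply, conj_trivial,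
    Fintype.sum_prod_type, sum_apply, smul_apply, smul_eq_mul, PiLp.proj_apply, Finset.mul_sum]
  refine Finset.sum_congr rfl fun j _ => Finset.sum_congr rfl fun a _ => ?_
  ring

theorem hasGradientAt_loss {n k d : ℕ} {φ : ℝ → ℝ} (hφ : Differentiable ℝ φ) (v : Fin k → ℝ)
    (x : Fin n → EuclideanSpace ℝ (Fin d)) (y : Fin n → ℝ) (W : Weights k d) :
    HasGradientAt (loss φ v x y)
      (∑ i, (network φ v W (x i) - y i) • netGrad φ v W (x i)) W := by
  rw [hasGradientAt_iff_hasFDerivAt]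
  have h := (HasFDerivAt.fun_sum (u := Finset.univ) fun i _ =>
    (((hasFDerivAt_network hφ v (x i) W).const_sub (y i)).pow 2)).const_mul (1 / 2)
  refine h.congr_fderiv ?_
  ext U
  simp only [smul_apply, sum_apply, neg_apply, innerSL_apply_apply, InnerProductSpace.toDual_apply_apply,
    sum_inner, real_inner_smul_left, smul_eq_mul, nsmul_eq_mul, Finset.mul_sum]
  refine Finset.sum_congr rfl fun i _ => ?_
  push_cast
  ring

/-- The vector of the network outputs at the points `c l`, with weights `s l`. -/
noncomputable def weightedNet {k d K : ℕ} (φ : ℝ → ℝ) (v : Fin k → ℝ) (s : Fin K → ℝ)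
    (c : Fin K → EuclideanSpace ℝ (Fin d)) (W : Weights k d) : EuclideanSpace ℝ (Fin K) :=
  WithLp.toLp 2 fun l => s l * network φ v W (c l)

/-- The adjoint of the Jacobian of `weightedNet`. -/
noncomputable def weightedGrad {k d K : ℕ} (φ : ℝ → ℝ) (v : Fin k → ℝ) (s : Fin K → ℝ)
    (c : Fin K → EuclideanSpace ℝ (Fin d)) (W : Weights k d) :
    EuclideanSpace ℝ (Fin K) →L[ℝ] Weights k d :=
  ∑ l, s l • (EuclideanSpace.proj l : EuclideanSpace ℝ (Fin K) →L[ℝ] ℝ).smulRight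
    (netGrad φ v W (c l))

section
variable {k d K : ℕ} {φ : ℝ → ℝ} (v : Fin k → ℝ) (s : Fin K → ℝ)
    (c : Fin K → EuclideanSpace ℝ (Fin d))

theorem weightedGrad_apply (W : Weights k d) (r : EuclideanSpace ℝ (Fin K)) :
    weightedGrad φ v s c W r = ∑ l, (s l * r l) • netGrad φ v W (c l) := by
  simp [weightedGrad, smul_smul]

theorem weightedGrad_apply_apply (W : Weights k d) (r : EuclideanSpace ℝ (Fin K))
    (p : Fin k × Fin d) :
    weightedGrad φ v s c W r p
      = ∑ l, (v p.1 * deriv φ (∑ a, W (p.1, a) * c l a) * (s l * r l)) * c l p.2 := by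
  rw [weightedGrad_apply]
  simp [netGrad]
  refine Finset.sum_congr rfl fun l _ => ?_
  ring

theorem hasFDerivAt_weightedNet (hφ : Differentiable ℝ φ) (W : Weights k d) :
    HasFDerivAt (weightedNet φ v s c) (ContinuousLinearMap.adjoint (weightedGrad φ v s c W)) W := by
  rw [← hasFDerivWithinAt_univ, hasFDerivWithinAt_euclidean]
  intro l
  rw [hasFDerivWithinAt_univ]
  refine ((hasFDerivAt_network hφ v (c l) W).const_mul (s l)).congr_fderiv ?_
  ext U
  rw [ContinuousLinearMap.comp_apply, PiLp.proj_apply]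
  have h1 : ∀ u : EuclideanSpace ℝ (Fin K), u l = inner ℝ (EuclideanSpace.single l (1 : ℝ)) u :=
    fun u => by rw [EuclideanSpace.inner_single_left]; simp
  rw [h1, ContinuousLinearMap.adjoint_inner_right, weightedGrad_apply, sum_inner]
  simp only [real_inner_smul_left, PiLp.single_apply, smul_apply, innerSL_apply_apply, smul_eq_mul]
  simp

/-- This is `‖Q C‖_F ≤ ‖C‖ ‖Q‖_F`, applied row by row. The adjoint Jacobian and its increments both
have the form `Q C`, with the activation factors collected in `Q`. -/
theorem norm_sq_le_of_apply_eq (U : Weights k d) (q : Fin k → Fin K → ℝ)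
    (hU : ∀ j a, U (j, a) = ∑ l, q j l * c l a) :
    ‖U‖ ^ 2 ≤ specNorm (Matrix.of fun l a => c l a) ^ 2 * ∑ j, ∑ l, q j l ^ 2 := by
  rw [EuclideanSpace.real_norm_sq_eq, Fintype.sum_prod_type, Finset.mul_sum]
  refine Finset.sum_le_sum fun j _ => ?_
  simp_rw [hU]
  exact sum_sq_sum_mul_le (Matrix.of fun l a => c l a) (q j)

theorem norm_weightedGrad_le {Γ N : ℝ} (hΓ : 0 ≤ Γ) (hN : 0 ≤ N) (hφ : ∀ z, |deriv φ z| ≤ Γ)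
    (hv : ∑ j, v j ^ 2 ≤ 1) (hs : ∀ l, s l ^ 2 ≤ N) (W : Weights k d) :
    ‖weightedGrad φ v s c W‖
      ≤ Real.sqrt N * Γ * specNorm (Matrix.of fun l a => c l a) := by
  set S := specNorm (Matrix.of fun l a => c l a) with hS
  have hS0 : 0 ≤ S := specNorm_nonneg _
  refine ContinuousLinearMap.opNorm_le_bound _ (by positivity) fun r => ?_
  refine abs_le_of_sq_le_sq' ?_ (by positivity) |>.2
  refine (norm_sq_le_of_apply_eq c _
    (fun j l => v j * deriv φ (∑ a, W (j, a) * c l a) * (s l * r l))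
    fun j a => weightedGrad_apply_apply v s c W r (j, a)).trans ?_
  have : ∀ j l, (v j * deriv φ (∑ a, W (j, a) * c l a) * (s l * r l)) ^ 2
      ≤ v j ^ 2 * (Γ ^ 2 * N * r l ^ 2) := fun j l => by
    have h1 : deriv φ (∑ a, W (j, a) * c l a) ^ 2 ≤ Γ ^ 2 := sq_le_sq' (neg_le_of_abs_le (hφ _))
      (le_of_abs_le (hφ _))
    calc _ = v j ^ 2 * (deriv φ (∑ a, W (j, a) * c l a) ^ 2 * s l ^ 2 * r l ^ 2) := by ring
      _ ≤ _ := by gcongr; exact hs l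
  calc _ ≤ S ^ 2 * ∑ j, ∑ l, v j ^ 2 * (Γ ^ 2 * N * r l ^ 2) := by
        gcongr with j _ l _; exact this j l
    _ = S ^ 2 * (Γ ^ 2 * N * ∑ l, r l ^ 2) * ∑ j, v j ^ 2 := by
        simp_rw [← Finset.mul_sum]; rw [← Finset.sum_mul]; ring
    _ ≤ S ^ 2 * (Γ ^ 2 * N * ∑ l, r l ^ 2) * 1 := by gcongr
    _ = (Real.sqrt N * Γ * S * ‖r‖) ^ 2 := by
        rw [← EuclideanSpace.real_norm_sq_eq]
        simp only [mul_pow, Real.sq_sqrt hN]; ring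

/-- The gain from width: each `|v_j|` is at most `b`, later `1/√k`, whereas the changes of the
preactivations at a unit vector, squared and summed over all neurons, stay below `‖W - W'‖²` by
Cauchy-Schwarz. -/
theorem norm_weightedGrad_sub_le {Γ N b : ℝ} (hΓ : 0 ≤ Γ) (hN : 0 ≤ N) (hb : 0 ≤ b)
    (hφ' : Differentiable ℝ (deriv φ)) (hφ : ∀ z, |deriv (deriv φ) z| ≤ Γ)
    (hv : ∀ j, v j ^ 2 ≤ b ^ 2) (hs : ∀ l, s l ^ 2 ≤ N) (hc : ∀ l, ‖c l‖ = 1)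
    (W W' : Weights k d) :
    ‖weightedGrad φ v s c W - weightedGrad φ v s c W'‖
      ≤ Real.sqrt N * Γ * specNorm (Matrix.of fun l a => c l a) * b * ‖W - W'‖ := by
  set S := specNorm (Matrix.of fun l a => c l a) with hS
  have hS0 : 0 ≤ S := specNorm_nonneg _
  refine ContinuousLinearMap.opNorm_le_bound _ (by positivity) fun r => ?_
  refine abs_le_of_sq_le_sq' ?_ (by positivity) |>.2
  refine (norm_sq_le_of_apply_eq c _ (fun j l => v j * (deriv φ (∑ a, W (j, a) * c l a) -
    deriv φ (∑ a, W' (j, a) * c l a)) * (s l * r l)) fun j a => ?_).trans ?_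
  · rw [sub_apply, PiLp.sub_apply, weightedGrad_apply_apply,
      weightedGrad_apply_apply, ← Finset.sum_sub_distrib]
    refine Finset.sum_congr rfl fun l _ => ?_
    ring
  have hlip : ∀ x y, |deriv φ x - deriv φ y| ≤ Γ * |x - y| := fun x y => by
    have := Convex.norm_image_sub_le_of_norm_deriv_le (f := deriv φ) (C := Γ) (s := Set.univ)
      (fun x _ => hφ' x) (fun x _ => hφ x) convex_univ (Set.mem_univ y) (Set.mem_univ x)
    simpa using this
  have hCS : ∀ l, ∑ j, (∑ a, W (j, a) * c l a - ∑ a, W' (j, a) * c l a) ^ 2 ≤ ‖W - W'‖ ^ 2 := by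
    intro l
    rw [EuclideanSpace.real_norm_sq_eq, Fintype.sum_prod_type]
    refine Finset.sum_le_sum fun j _ => ?_
    have h := Finset.sum_mul_sq_le_sq_mul_sq Finset.univ (fun a => (W - W') (j, a)) (fun a => c l a)
    rw [← EuclideanSpace.real_norm_sq_eq, hc] at h
    simpa [← Finset.sum_sub_distrib, ← sub_mul] using h
  have : ∀ j l, (v j * (deriv φ (∑ a, W (j, a) * c l a) -
      deriv φ (∑ a, W' (j, a) * c l a)) * (s l * r l)) ^ 2
      ≤ b ^ 2 * Γ ^ 2 * N * r l ^ 2 *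
        (∑ a, W (j, a) * c l a - ∑ a, W' (j, a) * c l a) ^ 2 := fun j l => by
    have h1 : (deriv φ (∑ a, W (j, a) * c l a) - deriv φ (∑ a, W' (j, a) * c l a)) ^ 2
        ≤ (Γ * |∑ a, W (j, a) * c l a - ∑ a, W' (j, a) * c l a|) ^ 2 :=
      sq_le_sq' (neg_le_of_abs_le (hlip _ _)) (le_of_abs_le (hlip _ _))
    rw [mul_pow, sq_abs] at h1
    rw [mul_pow, mul_pow, mul_pow]
    calc _ ≤ b ^ 2 * (Γ ^ 2 * (∑ a, W (j, a) * c l a - ∑ a, W' (j, a) * c l a) ^ 2)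
          * (N * r l ^ 2) := 
            mul_le_mul (mul_le_mul (hv j) h1 (sq_nonneg _) (sq_nonneg _))
              (mul_le_mul_of_nonneg_right (hs l) (sq_nonneg _)) (by positivity) (by positivity)
      _ = _ := by ring
  calc _ ≤ S ^ 2 * ∑ j, ∑ l, b ^ 2 * Γ ^ 2 * N * r l ^ 2 *
        (∑ a, W (j, a) * c l a - ∑ a, W' (j, a) * c l a) ^ 2 := by
        gcongr with j _ l _; exact this j l
    _ = S ^ 2 * ∑ l, b ^ 2 * Γ ^ 2 * N * r l ^ 2 *
        ∑ j, (∑ a, W (j, a) * c l a - ∑ a, W' (j, a) * c l a) ^ 2 := by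
        rw [Finset.sum_comm]; simp_rw [← Finset.mul_sum]
    _ ≤ S ^ 2 * ∑ l, b ^ 2 * Γ ^ 2 * N * r l ^ 2 * ‖W - W'‖ ^ 2 := by
        gcongr with l; exact hCS l
    _ = (Real.sqrt N * Γ * S * b * ‖W - W'‖ * ‖r‖) ^ 2 := by
        rw [← Finset.sum_mul, ← Finset.mul_sum, ← EuclideanSpace.real_norm_sq_eq]
        simp only [mul_pow, Real.sq_sqrt hN]; ring
end

/-! ### Conditioning of the Jacobian in terms of the covariance -/

theorem minEigCov_mul_le {K d : ℕ} (φ : ℝ → ℝ) (C : Matrix (Fin K) (Fin d) ℝ) (z : Fin K → ℝ) :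
    minEigCov φ C * ∑ l, z l ^ 2 ≤ ∑ l, ∑ m, z l * z m * netCov φ C l m := by
  set hA := netCov_isHermitian φ C
  set b := hA.eigenvectorBasis
  set x : EuclideanSpace ℝ (Fin K) := WithLp.toLp 2 z with hx
  have hT : (Matrix.toEuclideanLin (netCov φ C)).IsSymmetric :=
    Matrix.isSymmetric_toEuclideanLin_iff.2 hA
  have hb : ∀ i, Matrix.toEuclideanLin (netCov φ C) (b i) = hA.eigenvalues i • b i := fun i => by
    rw [Matrix.toLpLin_apply, hA.mulVec_eigenvectorBasis]
    simp [b]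
  have hquad : ∑ l, ∑ m, z l * z m * netCov φ C l m
      = inner ℝ x (Matrix.toEuclideanLin (netCov φ C) x) := by
    simp only [hx, PiLp.inner_apply, Matrix.toLpLin_apply, Matrix.mulVec, dotProduct,
      RCLike.inner_apply, conj_trivial, Finset.sum_mul]
    refine Finset.sum_congr rfl fun l _ => Finset.sum_congr rfl fun m _ => ?_
    ring
  rw [hquad, ← b.sum_inner_mul_inner x]
  have hn : ∑ l, z l ^ 2 = ∑ i, inner ℝ x (b i) * inner ℝ (b i) x := by
    rw [b.sum_inner_mul_inner, real_inner_self_eq_norm_sq, EuclideanSpace.real_norm_sq_eq]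
  rw [hn, Finset.mul_sum]
  refine Finset.sum_le_sum fun i _ => ?_
  rw [← hT, hb, real_inner_smul_left, real_inner_comm (b i) x]
  have h1 : minEigCov φ C ≤ hA.eigenvalues i := ciInf_le (Set.finite_range _).bddBelow i
  nlinarith [mul_self_nonneg (inner ℝ x (b i) : ℝ)]

/-- Row `l` of `C Cᵀ` is `C c_l` with `c_l` a unit vector. This is the source of the factor `K ‖C‖²`
in the width condition. -/
theorem sum_sq_gram_le {K d : ℕ} (C : Matrix (Fin K) (Fin d) ℝ) (hC : ∀ l, ∑ a, C l a ^ 2 = 1) :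
    ∑ l, ∑ m, (C * C.transpose) l m ^ 2 ≤ specNorm C ^ 2 * K := by
  have : ∀ l, ∑ m, (C * C.transpose) l m ^ 2 ≤ specNorm C ^ 2 := fun l => by
    have h := norm_toEuclideanLin_le C (WithLp.toLp 2 (C l))
    have h2 : ‖(WithLp.toLp 2 (C l) : EuclideanSpace ℝ (Fin d))‖ = 1 := by
      rw [EuclideanSpace.norm_eq]; simp [hC]
    rw [h2, mul_one] at h
    have h3 := pow_le_pow_left₀ (norm_nonneg _) h 2
    rw [EuclideanSpace.real_norm_sq_eq] at h3
    refine le_of_eq_of_le (Finset.sum_congr rfl fun m _ => ?_) h3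
    simp [Matrix.toLpLin_apply, Matrix.mulVec, dotProduct, Matrix.mul_apply, mul_comm]
  calc _ ≤ ∑ _l : Fin K, specNorm C ^ 2 := Finset.sum_le_sum fun l _ => this l
    _ = _ := by simp [mul_comm]

/-- The Frobenius norm of a Hadamard product `G ⊙ E` is at most the largest entry of `E` times that
of `G`, and it bounds the quadratic form by Cauchy-Schwarz over pairs. -/
theorem abs_sum_sum_mul_le {K : ℕ} (G E : Fin K → Fin K → ℝ) (z : Fin K → ℝ) {t g : ℝ}
    (hg : 0 ≤ g) (hE : ∀ l m, |E l m| ≤ t) (hG : ∑ l, ∑ m, G l m ^ 2 ≤ g ^ 2) :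
    |∑ l, ∑ m, z l * z m * (G l m * E l m)| ≤ t * g * ∑ l, z l ^ 2 := by
  rw [← Fintype.sum_prod_type' (f := fun l m => G l m ^ 2)] at hG
  rw [← Fintype.sum_prod_type' (f := fun l m => z l * z m * (G l m * E l m))]
  have hz : ∑ p : Fin K × Fin K, |z p.1 * z p.2| ^ 2 = (∑ l, z l ^ 2) ^ 2 := by
    rw [Fintype.sum_prod_type, sq (∑ l, z l ^ 2), Finset.sum_mul_sum]
    simp_rw [sq_abs, mul_pow]
  have hz0 : 0 ≤ ∑ l, z l ^ 2 := Finset.sum_nonneg fun _ _ => sq_nonneg _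
  have hcs : ∑ p : Fin K × Fin K, |z p.1 * z p.2| * |G p.1 p.2| ≤ g * ∑ l, z l ^ 2 := by
    refine abs_le_of_sq_le_sq' ?_ (by positivity) |>.2
    refine (Finset.sum_mul_sq_le_sq_mul_sq _ _ _).trans ?_
    rw [hz, mul_pow, mul_comm]
    simp_rw [sq_abs]
    gcongr
  rcases isEmpty_or_nonempty (Fin K) with hK | ⟨⟨l₀⟩⟩
  · simp
  have ht : 0 ≤ t := (abs_nonneg _).trans (hE l₀ l₀)
  calc _ ≤ ∑ p : Fin K × Fin K, |z p.1 * z p.2 * (G p.1 p.2 * E p.1 p.2)| :=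
        Finset.abs_sum_le_sum_abs _ _
    _ ≤ ∑ p : Fin K × Fin K, |z p.1 * z p.2| * |G p.1 p.2| * t := by
        refine Finset.sum_le_sum fun p _ => ?_
        rw [abs_mul, abs_mul (G _ _), ← mul_assoc]
        gcongr
        exact hE _ _
    _ ≤ g * (∑ l, z l ^ 2) * t := by
        rw [← Finset.sum_mul]
        gcongr
    _ = _ := by ring

/-- The covariance integrand. -/
noncomputable def actCov {K d : ℕ} (φ : ℝ → ℝ) (c : Fin K → EuclideanSpace ℝ (Fin d))
    (l m : Fin K) : ℝ :=
  ∫ g : EuclideanSpace ℝ (Fin d),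
    deriv φ (∑ a, c l a * g a) * deriv φ (∑ a, c m a * g a) ∂stdNormal (Fin d)

/-- The Jacobian is well conditioned if the empirical covariance is entrywise close to its mean. -/
theorem le_norm_weightedGrad_sq {k d K : ℕ} {φ : ℝ → ℝ} (v : Fin k → ℝ) (s : Fin K → ℝ)
    (c : Fin K → EuclideanSpace ℝ (Fin d)) (hc : ∀ l, ‖c l‖ = 1) (W : Weights k d) {t σ : ℝ}
    (hσ : σ ≤ ∑ j, v j ^ 2) (hpos : 0 ≤ minEigCov φ (Matrix.of fun l a => c l a))
    (ht : ∀ l m, |∑ j, v j ^ 2 * (deriv φ (∑ a, c l a * W (j, a)) *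
      deriv φ (∑ a, c m a * W (j, a)) - actCov φ c l m)| ≤ t) (r : EuclideanSpace ℝ (Fin K)) :
    (σ * minEigCov φ (Matrix.of fun l a => c l a)
        - t * (specNorm (Matrix.of fun l a => c l a) * Real.sqrt K)) * ∑ l, (s l * r l) ^ 2
      ≤ ‖weightedGrad φ v s c W r‖ ^ 2 := by
  set C : Matrix (Fin K) (Fin d) ℝ := Matrix.of fun l a => c l a with hC
  set z : Fin K → ℝ := fun l => s l * r l with hz
  set G : Fin K → Fin K → ℝ := fun l m => (C * C.transpose) l m with hG
  set E : Fin K → Fin K → ℝ := fun l m => ∑ j, v j ^ 2 * (deriv φ (∑ a, c l a * W (j, a)) *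
      deriv φ (∑ a, c m a * W (j, a)) - actCov φ c l m) with hE
  have hz0 : 0 ≤ ∑ l, z l ^ 2 := Finset.sum_nonneg fun _ _ => sq_nonneg _
  have h1 := abs_sum_sum_mul_le G E z (t := t) (g := specNorm C * Real.sqrt K)
    (mul_nonneg (specNorm_nonneg C) (Real.sqrt_nonneg _)) ht (by
      rw [mul_pow, Real.sq_sqrt (Nat.cast_nonneg K)]
      refine sum_sq_gram_le C fun l => ?_
      rw [hC]
      simp only [Matrix.of_apply]
      rw [← EuclideanSpace.real_norm_sq_eq, hc, one_pow])
  have h2 := minEigCov_mul_le φ C z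
  -- The squared norm is the quadratic form of `(C Cᵀ) ⊙ ∑_j v_j² φ' φ'ᵀ` at `z`, split into its
  -- mean and its fluctuation.
  have h3 : ‖weightedGrad φ v s c W r‖ ^ 2
      = (∑ j, v j ^ 2) * (∑ l, ∑ m, z l * z m * netCov φ C l m)
        + ∑ l, ∑ m, z l * z m * (G l m * E l m) := by
    have hsplit : ∀ l m, (∑ j, v j ^ 2) * (z l * z m * netCov φ C l m)
        + z l * z m * (G l m * E l m)
        = ∑ j, ∑ a, (v j * deriv φ (∑ a, W (j, a) * c l a) * z l * c l a) *
          (v j * deriv φ (∑ a, W (j, a) * c m a) * z m * c m a) := fun l m => by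
      have hcov : netCov φ C l m = G l m * actCov φ c l m := rfl
      have hE' : E l m = ∑ j, v j ^ 2 * (deriv φ (∑ a, c l a * W (j, a)) *
          deriv φ (∑ a, c m a * W (j, a))) - (∑ j, v j ^ 2) * actCov φ c l m := by
        simp only [hE, mul_sub, Finset.sum_sub_distrib, Finset.sum_mul]
      have hG' : G l m = ∑ a, c l a * c m a := by
        simp [hG, hC, Matrix.mul_apply]
      rw [hcov, hE']
      have : (∑ j, v j ^ 2) * (z l * z m * (G l m * actCov φ c l m)) + z l * z m * (G l m *
          (∑ j, v j ^ 2 * (deriv φ (∑ a, c l a * W (j, a)) *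
          deriv φ (∑ a, c m a * W (j, a))) - (∑ j, v j ^ 2) * actCov φ c l m))
          = (∑ j, v j ^ 2 * (deriv φ (∑ a, c l a * W (j, a)) *
          deriv φ (∑ a, c m a * W (j, a)))) * (z l * z m * G l m) := by ring
      rw [this, hG', Finset.sum_mul]
      refine Finset.sum_congr rfl fun j _ => ?_
      rw [Finset.mul_sum, Finset.mul_sum]
      refine Finset.sum_congr rfl fun a _ => ?_
      simp_rw [mul_comm (W _)]
      ring
    rw [Finset.mul_sum, ← Finset.sum_add_distrib]
    have hsum : ∀ l, (∑ j, v j ^ 2) * (∑ m, z l * z m * netCov φ C l m)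
        + ∑ m, z l * z m * (G l m * E l m)
        = ∑ m, ∑ j, ∑ a, (v j * deriv φ (∑ a, W (j, a) * c l a) * z l * c l a) *
          (v j * deriv φ (∑ a, W (j, a) * c m a) * z m * c m a) := fun l => by
      rw [Finset.mul_sum, ← Finset.sum_add_distrib]
      exact Finset.sum_congr rfl fun m _ => hsplit l m
    rw [Finset.sum_congr rfl fun l _ => hsum l]
    rw [EuclideanSpace.real_norm_sq_eq, Fintype.sum_prod_type]
    have hterm : ∀ j a, (weightedGrad φ v s c W r (j, a)) ^ 2
        = ∑ l, ∑ m, (v j * deriv φ (∑ a, W (j, a) * c l a) * z l * c l a) *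
          (v j * deriv φ (∑ a, W (j, a) * c m a) * z m * c m a) := fun j a => by
      rw [weightedGrad_apply_apply, sq, Finset.sum_mul_sum]
    simp_rw [hterm]
    have : ∀ j, ∑ a, ∑ l, ∑ m, (v j * deriv φ (∑ a, W (j, a) * c l a) * z l * c l a) *
          (v j * deriv φ (∑ a, W (j, a) * c m a) * z m * c m a)
        = ∑ l, ∑ m, ∑ a, (v j * deriv φ (∑ a, W (j, a) * c l a) * z l * c l a) *
          (v j * deriv φ (∑ a, W (j, a) * c m a) * z m * c m a) := fun j => by
      rw [Finset.sum_comm]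
      exact Finset.sum_congr rfl fun l _ => Finset.sum_comm
    simp_rw [this]
    rw [Finset.sum_comm]
    exact Finset.sum_congr rfl fun l _ => Finset.sum_comm
  rw [h3]
  have h4 : σ * (minEigCov φ C * ∑ l, z l ^ 2)
      ≤ (∑ j, v j ^ 2) * (∑ l, ∑ m, z l * z m * netCov φ C l m) :=
    mul_le_mul hσ h2 (by positivity) (Finset.sum_nonneg fun _ _ => sq_nonneg _)
  have h5 := (abs_le.1 h1).1
  linarith

/-! ### Sub-Gaussian concentration at the Gaussian initialization -/

open scoped NNReal

instance isProbabilityMeasure_stdNormal (ι : Type) [Fintype ι] :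
    IsProbabilityMeasure (stdNormal ι) :=
  Measure.isProbabilityMeasure_map (by fun_prop)

/-- A standard normal matrix has i.i.d. standard normal rows. -/
theorem stdNormal_prod (k d : ℕ) :
    stdNormal (Fin k × Fin d)
      = (Measure.pi fun _ : Fin k => stdNormal (Fin d)).map
        (fun w => WithLp.toLp 2 fun p : Fin k × Fin d => w p.1 p.2) := by
  have h : (Measure.pi fun _ : Fin k × Fin d => gaussianReal 0 1)
      = (Measure.pi fun _ : Fin k => stdNormal (Fin d)).map
        (fun w (p : Fin k × Fin d) => w p.1 p.2) := by
    refine Measure.pi_eq fun s hs => ?_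
    rw [Measure.map_apply (by fun_prop) (MeasurableSet.univ_pi hs)]
    have hpre : (fun (w : Fin k → EuclideanSpace ℝ (Fin d)) (p : Fin k × Fin d) => w p.1 p.2) ⁻¹'
        Set.univ.pi s = Set.univ.pi fun j => {u | ∀ a, u a ∈ s (j, a)} := by
      ext w; simp
    rw [hpre, Measure.pi_pi, Fintype.prod_prod_type]
    refine Finset.prod_congr rfl fun j _ => ?_
    rw [stdNormal, Measure.map_apply (by fun_prop)]
    · have : (WithLp.toLp 2 ⁻¹' {u : EuclideanSpace ℝ (Fin d) | ∀ a, u a ∈ s (j, a)})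
          = Set.univ.pi fun a => s (j, a) := by
        ext w; simp
      rw [this, Measure.pi_pi]
    · have : {u : EuclideanSpace ℝ (Fin d) | ∀ a, u a ∈ s (j, a)}
          = ⋂ a, (fun u : EuclideanSpace ℝ (Fin d) => u a) ⁻¹' s (j, a) := by
        ext; simp
      rw [this]
      exact MeasurableSet.iInter fun a => (hs _).preimage (by fun_prop)
  rw [stdNormal, h, Measure.map_map (by fun_prop) (by fun_prop)]
  rfl

theorem ProbabilityTheory.HasSubgaussianMGF.mono {Ω : Type*} {mΩ : MeasurableSpace Ω}
    {μ : Measure Ω} {X : Ω → ℝ} {c c' : ℝ≥0} (h : HasSubgaussianMGF X c μ) (hc : c ≤ c') :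
    HasSubgaussianMGF X c' μ where
  integrable_exp_mul := h.integrable_exp_mul
  mgf_le t := (h.mgf_le t).trans (by gcongr)

theorem ProbabilityTheory.HasSubgaussianMGF.nnnorm_const_mul {Ω : Type*} {mΩ : MeasurableSpace Ω}
    {μ : Measure Ω} {X : Ω → ℝ} {c : ℝ≥0} (h : HasSubgaussianMGF X c μ) (r : ℝ) :
    HasSubgaussianMGF (fun ω => r * X ω) (‖r‖₊ ^ 2 * c) μ := by
  refine (h.const_mul r).mono (le_of_eq (NNReal.eq ?_))
  change r ^ 2 * c = _
  simp

theorem ProbabilityTheory.HasSubgaussianMGF.map_of_comp {Ω Ω' : Type*} {mΩ : MeasurableSpace Ω}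
    {mΩ' : MeasurableSpace Ω'} {μ : Measure Ω} {Y : Ω → Ω'} {X : Ω' → ℝ} {c : ℝ≥0}
    (hY : Measurable Y) (hX : Measurable X) (h : HasSubgaussianMGF (X ∘ Y) c μ) :
    HasSubgaussianMGF X c (μ.map Y) := by
  rw [← HasSubgaussianMGF.id_map_iff hX.aemeasurable, Measure.map_map hX hY]
  exact (HasSubgaussianMGF.id_map_iff (hX.comp hY).aemeasurable).2 h

theorem ProbabilityTheory.HasSubgaussianMGF.measure_abs_ge_le {Ω : Type*}
    {mΩ : MeasurableSpace Ω} {μ : Measure Ω} [IsFiniteMeasure μ] {X : Ω → ℝ} {c : ℝ≥0}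
    (h : HasSubgaussianMGF X c μ) {ε : ℝ} (hε : 0 ≤ ε) :
    μ.real {ω | ε ≤ |X ω|} ≤ 2 * Real.exp (-ε ^ 2 / (2 * c)) := by
  have hset : {ω | ε ≤ |X ω|} = {ω | ε ≤ X ω} ∪ {ω | ε ≤ (-X) ω} := by
    ext ω; simp [le_abs]
  rw [hset]
  refine (measureReal_union_le _ _).trans ?_
  linarith [h.measure_ge_le hε, h.neg.measure_ge_le hε]

/-- A sum of sub-Gaussian functions of the rows of a standard normal matrix is sub-Gaussian. -/
theorem hasSubgaussianMGF_sum_rows {k d : ℕ} {h : Fin k → EuclideanSpace ℝ (Fin d) → ℝ}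
    {c : Fin k → ℝ≥0} (hm : ∀ j, Measurable (h j))
    (hs : ∀ j, HasSubgaussianMGF (h j) (c j) (stdNormal (Fin d))) :
    HasSubgaussianMGF (fun W : Weights k d => ∑ j, h j (WithLp.toLp 2 fun a => W (j, a)))
      (∑ j, c j) (stdNormal (Fin k × Fin d)) := by
  rw [stdNormal_prod]
  refine HasSubgaussianMGF.map_of_comp (by fun_prop) (by fun_prop) ?_
  refine HasSubgaussianMGF.sum_of_iIndepFun (X := fun j (w : Fin k → EuclideanSpace ℝ (Fin d)) =>
    h j (w j)) (iIndepFun_pi fun j => (hm j).aemeasurable) fun j _ => ?_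
  have h1 : HasSubgaussianMGF (h j) (c j)
      ((Measure.pi fun _ : Fin k => stdNormal (Fin d)).map (Function.eval j)) := by
    rw [Measure.pi_map_eval]
    simpa using hs j
  exact h1.of_map (measurable_pi_apply j).aemeasurable

theorem hasSubgaussianMGF_id_gaussianReal : HasSubgaussianMGF id 1 (gaussianReal 0 1) where
  integrable_exp_mul t := by simpa using integrable_exp_mul_gaussianReal t
  mgf_le t := by rw [mgf_id_gaussianReal]; simp

theorem hasSubgaussianMGF_sum_mul_stdNormal {d : ℕ} (c : EuclideanSpace ℝ (Fin d))
    (hc : ‖c‖ = 1) :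
    HasSubgaussianMGF (fun g : EuclideanSpace ℝ (Fin d) => ∑ a, c a * g a) 1
      (stdNormal (Fin d)) := by
  refine HasSubgaussianMGF.map_of_comp (by fun_prop) (by fun_prop) ?_
  have h := HasSubgaussianMGF.sum_of_iIndepFun (μ := Measure.pi fun _ : Fin d => gaussianReal 0 1)
    (X := fun a (w : Fin d → ℝ) => c a * w a) (s := Finset.univ)
    (c := fun a => ‖c a‖₊ ^ 2)
    (iIndepFun_pi (X := fun a (x : ℝ) => c a * x) fun a => by fun_prop) fun a _ => by
      have h1 : HasSubgaussianMGF (fun x : ℝ => c a * x) (‖c a‖₊ ^ 2)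
          ((Measure.pi fun _ : Fin d => gaussianReal 0 1).map (Function.eval a)) := by
        rw [Measure.pi_map_eval]
        simp only [measure_univ, Finset.prod_const_one, one_smul]
        simpa using hasSubgaussianMGF_id_gaussianReal.nnnorm_const_mul (c a)
      exact h1.of_map (measurable_pi_apply a).aemeasurable
  refine h.mono (le_of_eq ?_)
  ext
  have := EuclideanSpace.real_norm_sq_eq c
  rw [hc, one_pow] at this
  push_cast
  simpa using this.symm

/-- A centered Lipschitz function of a sub-Gaussian variable is sub-Gaussian. -/
theorem hasSubgaussianMGF_of_lipschitz {ν : Measure ℝ} [IsProbabilityMeasure ν] {c Γ : ℝ≥0}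
    (hν : HasSubgaussianMGF id c ν) {ψ : ℝ → ℝ} (hψ : ∀ x y, |ψ x - ψ y| ≤ Γ * |x - y|)
    (hm : Measurable ψ) (h0 : ∫ x, ψ x ∂ν = 0) :
    HasSubgaussianMGF ψ (2 * Γ ^ 2 * c) ν := by
  have hint : ∀ t : ℝ, Integrable (fun x => Real.exp (t * ψ x)) ν := fun t => by
    have hdom : Integrable (fun x => Real.exp (|t| * |ψ 0|) *
        (Real.exp ((|t| * Γ) * x) + Real.exp (-(|t| * Γ) * x))) ν :=
      ((hν.integrable_exp_mul _).add (hν.integrable_exp_mul _)).const_mul _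
    refine hdom.mono' (by fun_prop) (ae_of_all _ fun x => ?_)
    rw [Real.norm_of_nonneg (Real.exp_pos _).le]
    have h1 : t * ψ x ≤ |t| * |ψ 0| + |t| * Γ * |x| := by
      have := hψ x 0
      rw [sub_zero] at this
      have h2 : |ψ x| ≤ |ψ 0| + Γ * |x| := by
        have := abs_add_le (ψ x - ψ 0) (ψ 0)
        rw [sub_add_cancel] at this
        linarith
      calc t * ψ x ≤ |t * ψ x| := le_abs_self _
        _ = |t| * |ψ x| := abs_mul _ _
        _ ≤ |t| * (|ψ 0| + Γ * |x|) := by gcongr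
        _ = _ := by ring
    calc Real.exp (t * ψ x) ≤ Real.exp (|t| * |ψ 0| + |t| * Γ * |x|) := Real.exp_le_exp.2 h1
      _ = Real.exp (|t| * |ψ 0|) * Real.exp (|t| * Γ * |x|) := Real.exp_add _ _
      _ ≤ _ := by
        gcongr
        rcases abs_cases x with ⟨h, -⟩ | ⟨h, -⟩
        · rw [h]; linarith [Real.exp_pos (-(|t| * Γ) * x)]
        · rw [h, mul_neg, ← neg_mul]; linarith [Real.exp_pos ((|t| * Γ) * x)]
  refine ⟨hint, fun t => ?_⟩
  have hψi : Integrable ψ ν := by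
    refine (((hν.integrable.abs.const_mul (Γ : ℝ)).add (integrable_const |ψ 0|))).mono'
      (by fun_prop) (ae_of_all _ fun x => ?_)
    have h1 := hψ x 0
    have := abs_add_le (ψ x - ψ 0) (ψ 0)
    rw [sub_add_cancel] at this
    rw [sub_zero] at h1
    simp only [Real.norm_eq_abs, Pi.add_apply, id]
    linarith
  -- Jensen's inequality for a centered variable, through `1 + x ≤ exp x`.
  have hmgf_neg : 1 ≤ mgf ψ ν (-t) := by
    have h1 : ∫ x, (1 + -t * ψ x) ∂ν = 1 := by
      rw [integral_add (integrable_const _) (hψi.const_mul _), integral_const_mul, h0]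
      simp
    rw [mgf, ← h1]
    refine integral_mono ((integrable_const _).add (hψi.const_mul _)) (hint _) fun x => ?_
    have := Real.add_one_le_exp (-t * ψ x)
    simp only
    linarith
  have hprod : ∀ (X : ℝ → ℝ) (u : ℝ), (∀ t : ℝ, Integrable (fun x => Real.exp (t * X x)) ν) →
      Integrable (fun p : ℝ × ℝ => Real.exp (u * (X p.1 - X p.2))) (ν.prod ν) ∧
      ∫ p, Real.exp (u * (X p.1 - X p.2)) ∂(ν.prod ν) = mgf X ν u * mgf X ν (-u) := by
    intro X u hX
    have he : (fun p : ℝ × ℝ => Real.exp (u * (X p.1 - X p.2)))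
        = fun p => Real.exp (u * X p.1) * Real.exp (-u * X p.2) := by
      ext p; rw [← Real.exp_add]; ring_nf
    rw [he]
    exact ⟨(hX u).mul_prod (hX (-u)), integral_prod_mul (fun x => Real.exp (u * X x))
      (fun x => Real.exp (-u * X x))⟩
  -- Symmetrization: the product is the moment generating function of `ψ x - ψ y` for independent
  -- `x`, `y`. By symmetry the exponential may be replaced by `cosh`, which is increasing in the
  -- absolute value and so respects the Lipschitz bound. The two factors on the right cause the 2 in
  -- the variance proxy.
  have hcosh : mgf ψ ν t * mgf ψ ν (-t) ≤ mgf id ν (t * Γ) * mgf id ν (-(t * Γ)) := by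
    obtain ⟨a1, a2⟩ := hprod ψ t hint
    obtain ⟨b1, b2⟩ := hprod ψ (-t) hint
    obtain ⟨c1, c2⟩ := hprod id (t * Γ) hν.integrable_exp_mul
    obtain ⟨d1, d2⟩ := hprod id (-(t * Γ)) hν.integrable_exp_mul
    have hle := integral_mono (a1.add b1) (c1.add d1) fun p => by
      have h : Real.cosh (t * (ψ p.1 - ψ p.2)) ≤ Real.cosh (t * Γ * (p.1 - p.2)) := by
        rw [Real.cosh_le_cosh, abs_mul, abs_mul, abs_mul, mul_assoc]
        gcongr
        simpa using hψ p.1 p.2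
      rw [Real.cosh_eq, Real.cosh_eq] at h
      simp only [Pi.add_apply, neg_mul, id]
      linarith
    rw [integral_add' a1 b1, integral_add' c1 d1, a2, b2, c2, d2, neg_neg, neg_neg] at hle
    linarith
  calc mgf ψ ν t ≤ mgf ψ ν t * mgf ψ ν (-t) := le_mul_of_one_le_right mgf_nonneg hmgf_neg
    _ ≤ _ := hcosh
    _ ≤ Real.exp (c * (t * Γ) ^ 2 / 2) * Real.exp (c * (-(t * Γ)) ^ 2 / 2) :=
        mul_le_mul (hν.mgf_le _) (hν.mgf_le _) mgf_nonneg (Real.exp_pos _).le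
    _ = _ := by rw [← Real.exp_add]; push_cast; ring_nf

/-- Hoeffding's inequality: row `j` contributes a centered variable with values in an interval of
length `2 Γ² v_j²`, hence proxy at most `Γ⁴/k²`, and the `k` rows are independent. -/
theorem measure_empiricalCov_ge_le {k d K : ℕ} {φ : ℝ → ℝ} {v : Fin k → ℝ}
    (c : Fin K → EuclideanSpace ℝ (Fin d)) {Γ t : ℝ} (hΓ : 0 < Γ) (hk : 0 < k)
    (hφ : Differentiable ℝ (deriv φ)) (hφΓ : ∀ z, |deriv φ z| ≤ Γ) (hv : ∀ j, v j ^ 2 ≤ 1 / k)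
    (ht : 0 ≤ t) (l m : Fin K) :
    (stdNormal (Fin k × Fin d)).real {W : Weights k d |
      t ≤ |∑ j, v j ^ 2 * (deriv φ (∑ a, c l a * W (j, a)) *
        deriv φ (∑ a, c m a * W (j, a)) - actCov φ c l m)|}
      ≤ 2 * Real.exp (-(t ^ 2 * k / (2 * Γ ^ 4))) := by
  have hφc : Continuous (deriv φ) := hφ.continuous
  have hk' : (0 : ℝ) < k := by exact_mod_cast hk
  set X : EuclideanSpace ℝ (Fin d) → ℝ := fun g =>
    deriv φ (∑ a, c l a * g a) * deriv φ (∑ a, c m a * g a) with hX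
  have hXc : Measurable X := by
    have : Continuous X := by fun_prop
    exact this.measurable
  have hXb : ∀ g, X g ∈ Set.Icc (-Γ ^ 2) (Γ ^ 2) := fun g => by
    have : |X g| ≤ Γ ^ 2 := by
      rw [hX, abs_mul, sq]
      exact mul_le_mul (hφΓ _) (hφΓ _) (abs_nonneg _) hΓ.le
    exact ⟨by linarith [(abs_le.1 this).1], (abs_le.1 this).2⟩
  have hsub := hasSubgaussianMGF_sum_rows (k := k)
    (h := fun j g => v j ^ 2 * (X g - ∫ g, X g ∂stdNormal (Fin d)))
    (fun j => by fun_prop) (fun j => (hasSubgaussianMGF_of_mem_Icc hXc.aemeasurable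
      (ae_of_all _ hXb)).nnnorm_const_mul (v j ^ 2))
  have hV : (∑ j, ‖v j ^ 2‖₊ ^ 2 * (‖Γ ^ 2 - -Γ ^ 2‖₊ / 2) ^ 2) ≤ (Γ ^ 4 / k).toNNReal := by
    rw [← NNReal.coe_le_coe, Real.coe_toNNReal _ (by positivity)]
    push_cast
    have h1 : Γ ^ 2 - -Γ ^ 2 = 2 * Γ ^ 2 := by ring
    simp only [h1, norm_mul, norm_pow, Real.norm_eq_abs, sq_abs, abs_two]
    calc ∑ j, (v j ^ 2) ^ 2 * (2 * Γ ^ 2 / 2) ^ 2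
        ≤ ∑ _j : Fin k, (1 / (k : ℝ)) ^ 2 * (2 * Γ ^ 2 / 2) ^ 2 := by
          gcongr with j; exact hv j
      _ = Γ ^ 4 / k := by
          rw [Finset.sum_const, Finset.card_univ, Fintype.card_fin, nsmul_eq_mul]
          field_simp
  refine ((hsub.mono hV).measure_abs_ge_le ht).trans (le_of_eq ?_)
  rw [Real.coe_toNNReal _ (by positivity)]
  congr 2
  field_simp

/-- As `∑ v_j = 0`, `φ` can be centered without changing the output. Each neuron is then a centered
`Γ`-Lipschitz function of a sub-Gaussian preactivation, and the proxies sum to at most `2 Γ²`. -/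
theorem measure_network_ge_le {k d : ℕ} {φ : ℝ → ℝ} {v : Fin k → ℝ}
    (c : EuclideanSpace ℝ (Fin d)) (hc : ‖c‖ = 1) {Γ t : ℝ} (hΓ : 0 < Γ)
    (hφ : Differentiable ℝ φ) (hφΓ : ∀ z, |deriv φ z| ≤ Γ) (hv : ∑ j, v j ^ 2 ≤ 1)
    (hv0 : ∑ j, v j = 0) (ht : 0 ≤ t) :
    (stdNormal (Fin k × Fin d)).real {W : Weights k d | t ≤ |network φ v W c|}
      ≤ 2 * Real.exp (-(t ^ 2 / (4 * Γ ^ 2))) := by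
  set u : EuclideanSpace ℝ (Fin d) → ℝ := fun g => ∑ a, c a * g a with hu
  have hum : Measurable u := by fun_prop
  have husub : HasSubgaussianMGF u 1 (stdNormal (Fin d)) := hasSubgaussianMGF_sum_mul_stdNormal c hc
  set ν := (stdNormal (Fin d)).map u with hν
  have : IsProbabilityMeasure ν := Measure.isProbabilityMeasure_map hum.aemeasurable
  have hνsub : HasSubgaussianMGF id 1 ν := (HasSubgaussianMGF.id_map_iff hum.aemeasurable).2 husub
  have hφm : Measurable φ := hφ.continuous.measurable
  set Γ' : ℝ≥0 := Γ.toNNReal with hΓ'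
  have hΓc : (Γ' : ℝ) = Γ := Real.coe_toNNReal _ hΓ.le
  have hlip : ∀ x y, |φ x - φ y| ≤ Γ' * |x - y| := fun x y => by
    rw [hΓc]
    simpa using Convex.norm_image_sub_le_of_norm_deriv_le (f := φ) (C := Γ) (s := Set.univ)
      (fun x _ => hφ x) (fun x _ => hφΓ x) convex_univ (Set.mem_univ y) (Set.mem_univ x)
  set μ := ∫ x, φ x ∂ν with hμ
  have hφi : Integrable φ ν := by
    refine (((hνsub.integrable.abs.const_mul (Γ' : ℝ)).add (integrable_const |φ 0|))).mono'
      (by fun_prop) (ae_of_all _ fun x => ?_)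
    have h1 := hlip x 0
    have := abs_add_le (φ x - φ 0) (φ 0)
    rw [sub_add_cancel] at this
    rw [sub_zero] at h1
    simp only [Real.norm_eq_abs, Pi.add_apply, id]
    linarith
  have hψ := hasSubgaussianMGF_of_lipschitz hνsub (ψ := fun x => φ x - μ) (Γ := Γ')
    (fun x y => by simpa using hlip x y) (by fun_prop)
    (by rw [integral_sub hφi (integrable_const _)]; simp [hμ])
  have hψu : HasSubgaussianMGF (fun g => φ (u g) - μ) (2 * Γ' ^ 2 * 1) (stdNormal (Fin d)) :=
    HasSubgaussianMGF.of_map hum.aemeasurable hψ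
  have hsub := hasSubgaussianMGF_sum_rows (k := k) (h := fun j g => v j * (φ (u g) - μ))
    (fun j => by fun_prop) (fun j => hψu.nnnorm_const_mul (v j))
  have hV : (∑ j, ‖v j‖₊ ^ 2 * (2 * Γ' ^ 2 * 1)) ≤ 2 * Γ' ^ 2 := by
    rw [← Finset.sum_mul, mul_one]
    refine mul_le_of_le_one_left (by positivity) ?_
    rw [← NNReal.coe_le_coe]
    push_cast
    simpa using hv
  have hnet : ∀ W : Weights k d,
      ∑ j, v j * (φ (u (WithLp.toLp 2 fun a => W (j, a))) - μ) = network φ v W c := fun W => by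
    simp only [mul_sub, Finset.sum_sub_distrib, ← Finset.sum_mul, hv0, network, hu]
    simp [mul_comm (c _)]
  simp only [hnet] at hsub
  refine ((hsub.mono hV).measure_abs_ge_le ht).trans (le_of_eq ?_)
  push_cast
  rw [hΓc]
  congr 2
  field_simp
  ring

/-- With high probability, the empirical covariance is entrywise close to its mean and all the
initial outputs are small. -/
theorem le_measure_initialization {k d K : ℕ} {φ : ℝ → ℝ} {v : Fin k → ℝ}
    (c : Fin K → EuclideanSpace ℝ (Fin d)) (hc : ∀ l, ‖c l‖ = 1) {Γ t : ℝ} (hΓ : 0 < Γ)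
    (hk : 0 < k) (hK : 2 ≤ K)
    (hφ : Differentiable ℝ φ) (hφΓ : ∀ z, |deriv φ z| ≤ Γ)
    (hφ' : Differentiable ℝ (deriv φ)) (hv : ∀ j, v j ^ 2 ≤ 1 / k) (hv1 : ∑ j, v j ^ 2 ≤ 1)
    (hv0 : ∑ j, v j = 0) (ht : 0 ≤ t) (htk : 103 * Real.log K ≤ t ^ 2 * k / (2 * Γ ^ 4)) :
    1 - 2 / (K : ℝ) ^ 100 ≤ (stdNormal (Fin k × Fin d)).real {W : Weights k d |
      (∀ l m, |∑ j, v j ^ 2 * (deriv φ (∑ a, c l a * W (j, a)) *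
        deriv φ (∑ a, c m a * W (j, a)) - actCov φ c l m)| ≤ t) ∧
      ∀ l, |network φ v W (c l)| ≤ 21 * Γ * Real.sqrt (Real.log K)} := by
  have hK2 : (2 : ℝ) ≤ K := by exact_mod_cast hK
  have hlog : 0 ≤ Real.log K := Real.log_nonneg (by linarith)
  set A : Fin K → Fin K → Set (Weights k d) := fun l m => {W |
      t ≤ |∑ j, v j ^ 2 * (deriv φ (∑ a, c l a * W (j, a)) *
        deriv φ (∑ a, c m a * W (j, a)) - actCov φ c l m)|} with hA
  set B : Fin K → Set (Weights k d) := fun l =>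
    {W | 21 * Γ * Real.sqrt (Real.log K) ≤ |network φ v W (c l)|} with hB
  have hexp : ∀ (N : ℕ) (x : ℝ), N * Real.log K ≤ x → Real.exp (-x) ≤ 1 / (K : ℝ) ^ N := by
    intro N x hx
    calc Real.exp (-x) ≤ Real.exp (-(N * Real.log K)) := Real.exp_le_exp.2 (by linarith)
      _ = 1 / (K : ℝ) ^ N := by
        rw [Real.exp_neg, ← Real.log_pow, Real.exp_log (by positivity), one_div]
  -- Of the exponent 103, two powers of `K` pay for the pairs `(l, m)` and one for the factor 2, as
  -- `2 ≤ K`.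
  have hAm : ∀ l m, (stdNormal (Fin k × Fin d)).real (A l m) ≤ 2 * (1 / (K : ℝ) ^ 103) :=
    fun l m => (measure_empiricalCov_ge_le c hΓ hk hφ' hφΓ hv ht l m).trans (by
      gcongr
      exact hexp 103 _ (by exact_mod_cast htk))
  -- Only `K` events here, so 102 suffices; the constant 21 is chosen so that `21²/4 ≥ 102`.
  have hBm : ∀ l, (stdNormal (Fin k × Fin d)).real (B l) ≤ 2 * (1 / (K : ℝ) ^ 102) :=
    fun l => (measure_network_ge_le (c l) (hc l) hΓ hφ hφΓ hv1 hv0 (by positivity)).trans (by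
      gcongr
      refine hexp 102 _ ?_
      rw [mul_pow, mul_pow, Real.sq_sqrt hlog]
      have : 21 ^ 2 * Γ ^ 2 * Real.log K / (4 * Γ ^ 2) = 441 / 4 * Real.log K := by
        field_simp; ring
      rw [this]
      push_cast
      linarith)
  set S : Set (Weights k d) := {W |
      (∀ l m, |∑ j, v j ^ 2 * (deriv φ (∑ a, c l a * W (j, a)) *
        deriv φ (∑ a, c m a * W (j, a)) - actCov φ c l m)| ≤ t) ∧
      ∀ l, |network φ v W (c l)| ≤ 21 * Γ * Real.sqrt (Real.log K)} with hS
  -- Covering the whole space by `S` and the bad events needs only subadditivity, not measurability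
  -- of `S`.
  have hcover : Set.univ ⊆ S ∪ ((⋃ p : Fin K × Fin K, A p.1 p.2) ∪ ⋃ l, B l) := by
    intro W _
    by_contra h
    simp only [Set.mem_union, Set.mem_iUnion, not_or, not_exists, hA, hB, Set.mem_ofPred_eq,
      not_le] at h
    exact h.1 ⟨fun l m => (h.2.1 (l, m)).le, fun l => (h.2.2 l).le⟩
  have h1 : (1 : ℝ) ≤ (stdNormal (Fin k × Fin d)).real S
      + (∑ p : Fin K × Fin K, (stdNormal (Fin k × Fin d)).real (A p.1 p.2)
        + ∑ l, (stdNormal (Fin k × Fin d)).real (B l)) := by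
    calc (1 : ℝ) = (stdNormal (Fin k × Fin d)).real Set.univ := by simp
      _ ≤ _ := measureReal_mono hcover
      _ ≤ _ := measureReal_union_le _ _
      _ ≤ _ := by
        gcongr
        refine (measureReal_union_le _ _).trans ?_
        gcongr
        · exact measureReal_iUnion_fintype_le _
        · exact measureReal_iUnion_fintype_le _
  have hK0 : (0 : ℝ) < K := by linarith
  have h2 : ∑ p : Fin K × Fin K, (stdNormal (Fin k × Fin d)).real (A p.1 p.2) ≤ 1 / (K : ℝ) ^ 100 := by
    calc _ ≤ ∑ _p : Fin K × Fin K, 2 * (1 / (K : ℝ) ^ 103) :=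
          Finset.sum_le_sum fun p _ => hAm _ _
      _ = 2 / K * (1 / (K : ℝ) ^ 100) := by
          simp only [Finset.sum_const, Finset.card_univ, Fintype.card_prod, Fintype.card_fin,
            nsmul_eq_mul]
          push_cast
          field_simp
      _ ≤ 1 * (1 / (K : ℝ) ^ 100) := by
          gcongr
          rwa [div_le_one hK0]
      _ = _ := one_mul _
  have h3 : ∑ l, (stdNormal (Fin k × Fin d)).real (B l) ≤ 1 / (K : ℝ) ^ 100 := by
    calc _ ≤ ∑ _l : Fin K, 2 * (1 / (K : ℝ) ^ 102) := Finset.sum_le_sum fun l _ => hBm l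
      _ = 2 / K * (1 / (K : ℝ) ^ 100) := by
          simp only [Finset.sum_const, Finset.card_univ, Fintype.card_fin, nsmul_eq_mul]
          field_simp
      _ ≤ 1 * (1 / (K : ℝ) ^ 100) := by
          gcongr
          rwa [div_le_one hK0]
      _ = _ := one_mul _
  have h4 : (2 : ℝ) / (K : ℝ) ^ 100 = 1 / (K : ℝ) ^ 100 + 1 / (K : ℝ) ^ 100 := by ring
  linarith

/-! ### Output weights and a priori bounds on `λ(C)` and `‖C‖` -/

theorem IsBalancedOutput.sq_le {k : ℕ} {v : Fin k → ℝ} (hv : IsBalancedOutput v) (j : Fin k) :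
    v j ^ 2 ≤ 1 / k := by
  have h : (1 / Real.sqrt k) ^ 2 = 1 / k := by
    rw [div_pow, one_pow, Real.sq_sqrt (Nat.cast_nonneg k)]
  rcases hv.entries j with hj | hj | hj
  · rw [hj, h]
  · rw [hj, neg_sq, h]
  · rw [hj, zero_pow two_ne_zero]; positivity

theorem IsBalancedOutput.sum_eq_zero {k : ℕ} {v : Fin k → ℝ} (hv : IsBalancedOutput v)
    (hk : 0 < k) : ∑ j, v j = 0 := by
  have hpos : 0 < 1 / Real.sqrt k := by positivity
  have h : ∀ j, v j = (if v j = 1 / Real.sqrt k then 1 / Real.sqrt k else 0)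
      - (if v j = -(1 / Real.sqrt k) then 1 / Real.sqrt k else 0) := fun j => by
    rcases hv.entries j with hj | hj | hj
    · rw [if_pos hj, if_neg (by rw [hj]; intro h; linarith), hj, sub_zero]
    · rw [if_neg (by rw [hj]; intro h; linarith), if_pos hj, hj, zero_sub]
    · rw [if_neg (by rw [hj]; intro h; linarith), if_neg (by rw [hj]; intro h; linarith), hj,
        sub_zero]
  rw [Finset.sum_congr rfl fun j _ => h j, Finset.sum_sub_distrib, ← Finset.sum_filter,
    ← Finset.sum_filter, Finset.sum_const, Finset.sum_const, hv.card_pos, hv.card_neg, sub_self]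

theorem IsBalancedOutput.sum_sq {k : ℕ} {v : Fin k → ℝ} (hv : IsBalancedOutput v)
    (hk : 0 < k) : ∑ j, v j ^ 2 = 2 * (k / 2 : ℕ) / k := by
  have hpos : 0 < 1 / Real.sqrt k := by positivity
  have hsq : (1 / Real.sqrt k) ^ 2 = 1 / k := by
    rw [div_pow, one_pow, Real.sq_sqrt (Nat.cast_nonneg k)]
  have h : ∀ j, v j ^ 2 = (if v j = 1 / Real.sqrt k then (1 : ℝ) / k else 0)
      + (if v j = -(1 / Real.sqrt k) then (1 : ℝ) / k else 0) := fun j => by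
    rcases hv.entries j with hj | hj | hj
    · rw [if_pos hj, if_neg (by rw [hj]; intro h; linarith), hj, hsq, add_zero]
    · rw [if_neg (by rw [hj]; intro h; linarith), if_pos hj, hj, neg_sq, hsq, zero_add]
    · rw [if_neg (by rw [hj]; intro h; linarith), if_neg (by rw [hj]; intro h; linarith), hj]
      norm_num
  rw [Finset.sum_congr rfl fun j _ => h j, Finset.sum_add_distrib, ← Finset.sum_filter,
    ← Finset.sum_filter, Finset.sum_const, Finset.sum_const, hv.card_pos, hv.card_neg,
    nsmul_eq_mul]
  ring

theorem IsBalancedOutput.sum_sq_le_one {k : ℕ} {v : Fin k → ℝ} (hv : IsBalancedOutput v)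
    (hk : 0 < k) : ∑ j, v j ^ 2 ≤ 1 := by
  rw [hv.sum_sq hk, div_le_one (by exact_mod_cast hk)]
  exact_mod_cast Nat.mul_div_le k 2

/-- The worst case is `k = 3`, with one zero entry; for `k = 1` the sum vanishes. -/
theorem IsBalancedOutput.le_sum_sq {k : ℕ} {v : Fin k → ℝ} (hv : IsBalancedOutput v)
    (hk : 2 ≤ k) : 2 / 3 ≤ ∑ j, v j ^ 2 := by
  rw [hv.sum_sq (by omega), div_le_div_iff₀ (by norm_num) (by exact_mod_cast (by omega : 0 < k))]
  have : 2 * k ≤ 2 * (k / 2) * 3 := by omega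
  exact_mod_cast this

/-- The least eigenvalue is at most any diagonal entry. With `one_le_specNorm` this makes the width
factor at least 1, which excludes `k ≤ 1`. -/
theorem minEigCov_le {K d : ℕ} {φ : ℝ → ℝ} {Γ : ℝ} (hφ : ∀ z, |deriv φ z| ≤ Γ)
    (C : Matrix (Fin K) (Fin d) ℝ) (hC : ∀ l, ∑ a, C l a ^ 2 = 1) (l : Fin K) :
    minEigCov φ C ≤ Γ ^ 2 := by
  have h := minEigCov_mul_le φ C (Pi.single l 1)
  have h1 : ∑ m, (Pi.single l (1 : ℝ) : Fin K → ℝ) m ^ 2 = 1 := by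
    simp [Pi.single_apply]
  have h2 : ∑ i, ∑ m, (Pi.single l (1 : ℝ) : Fin K → ℝ) i * (Pi.single l (1 : ℝ) : Fin K → ℝ) m
      * netCov φ C i m = netCov φ C l l := by
    simp [Pi.single_apply]
  rw [h1, h2, mul_one] at h
  refine h.trans ?_
  have h3 : (C * C.transpose) l l = 1 := by
    rw [← hC l, Matrix.mul_apply]
    simp [sq]
  have h4 : netCov φ C l l = (C * C.transpose) l l * ∫ g : EuclideanSpace ℝ (Fin d),
      deriv φ (∑ a, C l a * g a) * deriv φ (∑ a, C l a * g a) ∂stdNormal (Fin d) := rfl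
  rw [h4, h3, one_mul]
  have h5 := norm_integral_le_of_norm_le_const (μ := stdNormal (Fin d)) (C := Γ ^ 2)
    (f := fun g : EuclideanSpace ℝ (Fin d) =>
      deriv φ (∑ a, C l a * g a) * deriv φ (∑ a, C l a * g a)) (ae_of_all _ fun g => by
        rw [norm_mul, ← sq, Real.norm_eq_abs]
        exact pow_le_pow_left₀ (abs_nonneg _) (hφ _) 2)
  rw [probReal_univ, mul_one] at h5
  exact (le_abs_self _).trans h5

theorem one_le_specNorm {K d : ℕ} (C : Matrix (Fin K) (Fin d) ℝ)
    (hC : ∀ l, ∑ a, C l a ^ 2 = 1) (l : Fin K) : 1 ≤ specNorm C := by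
  have h := sum_sq_sum_mul_le C (Pi.single l 1)
  have h1 : ∑ m, (Pi.single l (1 : ℝ) : Fin K → ℝ) m ^ 2 = 1 := by
    simp [Pi.single_apply]
  have h2 : ∑ a, (∑ i, (Pi.single l (1 : ℝ) : Fin K → ℝ) i * C i a) ^ 2 = 1 := by
    simp [Pi.single_apply, hC]
  rw [h1, h2, mul_one] at h
  exact abs_le_of_sq_le_sq' (by linarith : (1 : ℝ) ^ 2 ≤ _) (specNorm_nonneg C) |>.2

/-! ### Reduction from samples to cluster means -/

section Data

variable {n d K Kbar : ℕ} {clow cup ρ δ : ℝ}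

theorem ClusterableDataset.x_eq (D : ClusterableDataset n d K Kbar clow cup 0 δ) (i : Fin n) :
    D.x i = D.center (D.cluster i) := by
  have := D.dist_center i
  exact sub_eq_zero.1 (norm_le_zero_iff.1 this)

/-- The number of samples of a cluster. -/
def ClusterableDataset.clusterSize {ε₀ : ℝ} (D : ClusterableDataset n d K Kbar clow cup ε₀ δ)
    (l : Fin K) : ℕ :=
  (Finset.univ.filter fun i => D.cluster i = l).card

theorem ClusterableDataset.sum_clusterSize {ε₀ : ℝ}
    (D : ClusterableDataset n d K Kbar clow cup ε₀ δ) : ∑ l, D.clusterSize l = n := by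
  have := Finset.card_eq_sum_card_fiberwise (f := D.cluster) (s := Finset.univ)
    (t := Finset.univ) (fun _ _ => Finset.mem_univ _)
  rw [Finset.card_univ, Fintype.card_fin] at this
  exact this.symm

theorem ClusterableDataset.one_le_clusterSize {ε₀ : ℝ}
    (D : ClusterableDataset n d K Kbar clow cup ε₀ δ) (hlow : 0 < clow) (hn : 0 < n) (hK : 0 < K)
    (l : Fin K) : 1 ≤ D.clusterSize l := by
  have h := D.balanced_low l
  have h1 : 0 < clow * (n / K : ℝ) := by positivity
  have h2 : (0 : ℝ) < D.clusterSize l := h1.trans_le h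
  exact_mod_cast h2

/-- The mean of the observed labels in a cluster. -/
noncomputable def CorruptedDataset.meanLabel {ε₀ : ℝ}
    (D : CorruptedDataset n d K Kbar clow cup ρ ε₀ δ) (l : Fin K) : ℝ :=
  (∑ i with D.cluster i = l, D.y i) / D.clusterSize l

theorem CorruptedDataset.abs_y_le {ε₀ : ℝ} (D : CorruptedDataset n d K Kbar clow cup ρ ε₀ δ)
    (i : Fin n) : |D.y i| ≤ 1 := by
  obtain ⟨r, hr⟩ := D.y_mem i
  rw [← hr]
  exact abs_le.2 (D.label_mem r)

theorem CorruptedDataset.abs_meanLabel_le {ε₀ : ℝ}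
    (D : CorruptedDataset n d K Kbar clow cup ρ ε₀ δ) {l : Fin K} (hl : 1 ≤ D.clusterSize l) :
    |D.meanLabel l| ≤ 1 := by
  have hl' : (0 : ℝ) < D.clusterSize l := by exact_mod_cast hl
  rw [meanLabel, abs_div, abs_of_pos hl', div_le_one hl']
  refine (Finset.abs_sum_le_sum_abs _ _).trans ?_
  refine (Finset.sum_le_sum fun i _ => D.abs_y_le i).trans ?_
  simp [ClusterableDataset.clusterSize]

/-- Labels lie in `[-1, 1]`, so each of the at most `ρ n_l` wrong ones moves the sum by at most 2.
-/
theorem CorruptedDataset.abs_meanLabel_sub_le {ε₀ : ℝ}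
    (D : CorruptedDataset n d K Kbar clow cup ρ ε₀ δ) {l : Fin K} (hl : 1 ≤ D.clusterSize l) :
    |D.meanLabel l - D.α (D.cls l)| ≤ 2 * ρ := by
  have hl' : (0 : ℝ) < D.clusterSize l := by exact_mod_cast hl
  have h1 : D.meanLabel l - D.α (D.cls l)
      = (∑ i with D.cluster i = l, (D.y i - D.truth i)) / D.clusterSize l := by
    have h2 : ∑ i with D.cluster i = l, D.truth i = D.clusterSize l * D.α (D.cls l) := by
      rw [Finset.sum_congr rfl (g := fun _ => D.α (D.cls l)), Finset.sum_const, nsmul_eq_mul]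
      · rfl
      · intro i hi
        rw [ClusterableDataset.truth, (Finset.mem_filter.1 hi).2]
    rw [Finset.sum_sub_distrib, h2, meanLabel]
    field_simp
  rw [h1, abs_div, abs_of_pos hl', div_le_iff₀ hl']
  have h3 : ∀ i, |D.y i - D.truth i| ≤ if D.y i ≠ D.truth i then 2 else 0 := fun i => by
    split_ifs with h
    · refine (abs_sub _ _).trans ?_
      have : |D.truth i| ≤ 1 := abs_le.2 (D.label_mem _)
      linarith [D.abs_y_le i]
    · rw [not_not] at h
      simp [h]
  calc _ ≤ ∑ i with D.cluster i = l, |D.y i - D.truth i| := Finset.abs_sum_le_sum_abs _ _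
    _ ≤ ∑ i with D.cluster i = l, (if D.y i ≠ D.truth i then (2 : ℝ) else 0) :=
        Finset.sum_le_sum fun i _ => h3 i
    _ = 2 * ((Finset.univ.filter fun i => D.cluster i = l ∧ D.y i ≠ D.truth i).card : ℝ) := by
        rw [← Finset.sum_filter, Finset.filter_filter, Finset.sum_const, nsmul_eq_mul, mul_comm]
    _ ≤ 2 * (ρ * D.clusterSize l) := by
        gcongr
        exact D.corrupted_le l
    _ = _ := by ring

/-- The square root of the cluster sizes. -/
noncomputable def ClusterableDataset.clusterWeight {ε₀ : ℝ}
    (D : ClusterableDataset n d K Kbar clow cup ε₀ δ) (l : Fin K) : ℝ :=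
  Real.sqrt (D.clusterSize l)

/-- The weighted mean labels of the clusters. -/
noncomputable def CorruptedDataset.weightedLabel {ε₀ : ℝ}
    (D : CorruptedDataset n d K Kbar clow cup ρ ε₀ δ) : EuclideanSpace ℝ (Fin K) :=
  WithLp.toLp 2 fun l => D.clusterWeight l * D.meanLabel l

theorem ClusterableDataset.clusterWeight_sq {ε₀ : ℝ}
    (D : ClusterableDataset n d K Kbar clow cup ε₀ δ) (l : Fin K) :
    D.clusterWeight l ^ 2 = D.clusterSize l :=
  Real.sq_sqrt (Nat.cast_nonneg _)

theorem CorruptedDataset.weightedNet_sub_apply {ε₀ : ℝ} {k : ℕ} {φ : ℝ → ℝ} {v : Fin k → ℝ}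
    (D : CorruptedDataset n d K Kbar clow cup ρ ε₀ δ) (W : Weights k d) (l : Fin K) :
    (weightedNet φ v D.clusterWeight D.center W - D.weightedLabel) l
      = D.clusterWeight l * (network φ v W (D.center l) - D.meanLabel l) := by
  rw [PiLp.sub_apply, weightedNet, CorruptedDataset.weightedLabel]
  ring

theorem ClusterableDataset.card_clusters_le {ε₀ : ℝ}
    (D : ClusterableDataset n d K Kbar clow cup ε₀ δ) (hD : ∀ l, 1 ≤ D.clusterSize l) :
    K ≤ n := by
  rw [← D.sum_clusterSize]
  calc K = ∑ _l : Fin K, 1 := by simp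
    _ ≤ _ := Finset.sum_le_sum fun l _ => hD l

theorem ClusterableDataset.sum_sq_centerMatrix {ε₀ : ℝ}
    (D : ClusterableDataset n d K Kbar clow cup ε₀ δ) (l : Fin K) :
    ∑ a, D.centerMatrix l a ^ 2 = 1 := by
  have := EuclideanSpace.real_norm_sq_eq (D.center l)
  rw [D.norm_center, one_pow] at this
  exact this.symm

/-- With perfectly clustered data, the gradient of the loss only depends on the mean labels. -/
theorem CorruptedDataset.gradient_loss {k : ℕ} {φ : ℝ → ℝ} (hφ : Differentiable ℝ φ)
    (v : Fin k → ℝ) (D : CorruptedDataset n d K Kbar clow cup ρ 0 δ)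
    (hD : ∀ l, 1 ≤ D.clusterSize l) (W : Weights k d) :
    gradient (loss φ v D.x D.y) W = weightedGrad φ v D.clusterWeight D.center W
      (weightedNet φ v D.clusterWeight D.center W - D.weightedLabel) := by
  rw [(hasGradientAt_loss hφ v D.x D.y W).gradient, weightedGrad_apply,
    ← Finset.sum_fiberwise (g := D.cluster)]
  refine Finset.sum_congr rfl fun l _ => ?_
  have hl' : (0 : ℝ) < D.clusterSize l := by exact_mod_cast hD l
  rw [Finset.sum_congr rfl (g := fun i => (network φ v W (D.center l) - D.y i) •
    netGrad φ v W (D.center l))]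
  · rw [← Finset.sum_smul]
    congr 1
    rw [Finset.sum_sub_distrib, Finset.sum_const, nsmul_eq_mul]
    -- One factor `√n_l` comes from the Jacobian and one from the residual; `n_l` times the mean is
    -- the sum of the labels.
    rw [D.weightedNet_sub_apply, ← mul_assoc, ← sq, D.clusterWeight_sq, mul_sub, meanLabel,
      mul_div_cancel₀ _ hl'.ne']
    rfl
  · intro i hi
    rw [D.x_eq i, (Finset.mem_filter.1 hi).2]

end Data

/-! ### Classification margin and numerical estimates -/

theorem argminLabel_eq_singleton {Kbar : ℕ} {α : Fin Kbar → ℝ} {δ t : ℝ}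
    (hα : ∀ r s, r ≠ s → δ ≤ |α r - α s|) (r : Fin Kbar) (ht : |t - α r| < δ / 2) :
    argminLabel α t = {α r} := by
  have hlt : ∀ s, α s ≠ α r → |t - α r| < |t - α s| := fun s hs => by
    have h1 := hα r s fun h => hs (h ▸ rfl)
    have h2 : |α r - α s| ≤ |t - α r| + |t - α s| := by
      have := abs_sub (t - α s) (t - α r)
      have h3 : t - α s - (t - α r) = α r - α s := by ring
      rw [h3] at this
      linarith
    linarith
  ext a
  simp only [argminLabel, Set.mem_ofPred_eq, Set.mem_singleton_iff]
  constructor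
  · rintro ⟨⟨s, rfl⟩, hs⟩
    by_contra hne
    exact absurd (hs (α r) ⟨r, rfl⟩) (not_le.2 (hlt s hne))
  · rintro rfl
    refine ⟨⟨r, rfl⟩, ?_⟩
    rintro _ ⟨s, rfl⟩
    by_cases h : α s = α r
    · rw [h]
    · exact (hlt s h).le

/-- The number of gradient steps that suffices to reach accuracy `ρ`. -/
theorem pow_mul_le_of_log_le {q X ρ A : ℝ} (hq0 : q ≤ 1) (hρ : 0 < ρ)
    (hX : 1.38 ≤ X ^ 2) (hX0 : 0 < X) (τ : ℕ) (hτ : 25 * Real.log X ≤ q * τ)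
    (hA : A = 23 * (X * ρ)) : (1 - q) ^ τ * A ≤ ρ := by
  have h1 : (1 - q) ^ τ ≤ Real.exp (-(q * τ)) := by
    calc (1 - q) ^ τ ≤ Real.exp (-q) ^ τ := by
          gcongr
          linarith [Real.add_one_le_exp (-q)]
      _ = _ := by rw [← Real.exp_nat_mul]; ring_nf
  have h2 : Real.exp (-(q * τ)) ≤ 1 / X ^ 25 := by
    calc _ ≤ Real.exp (-(25 * Real.log X)) := Real.exp_le_exp.2 (by linarith)
      _ = _ := by
        rw [Real.exp_neg, one_div]
        congr 1
        have : (25 : ℝ) * Real.log X = Real.log (X ^ 25) := by rw [Real.log_pow]; norm_num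
        rw [this, Real.exp_log (by positivity)]
  -- One of the 25 powers of `X` cancels the `X` in `A`; the other 24 absorb the constant 23.
  have h3 : (23 : ℝ) ≤ X ^ 24 := by
    calc (23 : ℝ) ≤ 1.38 ^ 12 := by norm_num
      _ ≤ (X ^ 2) ^ 12 := by gcongr
      _ = _ := by ring
  calc (1 - q) ^ τ * A ≤ 1 / X ^ 25 * (23 * (X * ρ)) := by
        rw [hA]; gcongr; exact h1.trans h2
    _ = 23 / X ^ 24 * ρ := by field_simp
    _ ≤ 1 * ρ := by
        gcongr
        rwa [div_le_one (by positivity)]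
    _ = ρ := one_mul ρ

/-- Here `1.38 = 2 * 0.69`, from `n ≥ 2`, `log K ≥ log 2` and `Γ/ρ ≥ 1`. -/
theorem le_sq_log_argument {n K : ℕ} {Γ ρ X : ℝ} (hn : 2 ≤ n) (hK : 2 ≤ K) (hΓ : 1 ≤ Γ)
    (hρ : 0 < ρ) (hρ1 : ρ ≤ 1) (hX : X = Γ * Real.sqrt (n * Real.log K) / ρ) :
    0 < X ∧ 1.38 ≤ X ^ 2 := by
  have hn2 : (2 : ℝ) ≤ n := by exact_mod_cast hn
  have hlog2 : Real.log 2 ≤ Real.log K :=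
    Real.log_le_log (by norm_num) (by exact_mod_cast hK)
  have hlog : 0.69 ≤ Real.log K := by linarith [Real.log_two_gt_d9]
  refine ⟨by rw [hX]; positivity, ?_⟩
  have h1 : X ^ 2 = Γ ^ 2 / ρ ^ 2 * (n * Real.log K) := by
    rw [hX, div_pow, mul_pow, Real.sq_sqrt (by positivity)]; ring
  have h2 : 1 ≤ Γ ^ 2 / ρ ^ 2 := by
    rw [one_le_div (by positivity)]
    gcongr
    linarith
  have h3 : 1.38 ≤ n * Real.log K := by nlinarith
  rw [h1]
  nlinarith

/-- The width condition bounds the width from below by an absolute constant. -/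
theorem one_le_width_factor {K : ℕ} {Γ S lam : ℝ} (hK : 2 ≤ K) (hS : 1 ≤ S) (hlam : 0 < lam)
    (hlamΓ : lam ≤ Γ ^ 2) : 1 ≤ Γ ^ 4 * (K * Real.log K * S ^ 2 / lam ^ 2) := by
  have hK2 : (2 : ℝ) ≤ K := by exact_mod_cast hK
  have hlog2 : Real.log 2 ≤ Real.log K := Real.log_le_log (by norm_num) hK2
  have hlog : 0.69 ≤ Real.log K := by linarith [Real.log_two_gt_d9]
  have h1 : 1 ≤ K * Real.log K * S ^ 2 :=
    one_le_mul_of_one_le_of_one_le (by nlinarith) (one_le_pow₀ hS)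
  rw [← mul_div_assoc, one_le_div (by positivity)]
  calc lam ^ 2 ≤ (Γ ^ 2) ^ 2 := by gcongr
    _ = Γ ^ 4 * 1 := by ring
    _ ≤ _ := by gcongr

/-- The width condition makes the entrywise deviations of the empirical covariance small. -/
theorem log_le_of_width {k K : ℕ} {Γ S lam : ℝ} (hK : 0 < K) (hS : 0 < S) (hΓ : 0 < Γ)
    (hlam : 0 < lam) (hk : 7416 * (Γ ^ 4 * (K * Real.log K * S ^ 2 / lam ^ 2)) ≤ k) :
    103 * Real.log K ≤ (lam / (6 * (S * Real.sqrt K))) ^ 2 * k / (2 * Γ ^ 4) := by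
  have hKR : (0 : ℝ) < K := by exact_mod_cast hK
  have h1 : (lam / (6 * (S * Real.sqrt K))) ^ 2 = lam ^ 2 / (36 * (S ^ 2 * K)) := by
    rw [div_pow, mul_pow, mul_pow, Real.sq_sqrt hKR.le]; norm_num
  rw [h1]
  -- `7416 = 103 * 36 * 2`.
  calc 103 * Real.log K
      = lam ^ 2 / (36 * (S ^ 2 * K)) * (7416 * (Γ ^ 4 * (K * Real.log K * S ^ 2 / lam ^ 2)))
        / (2 * Γ ^ 4) := by
        field_simp; ring
    _ ≤ _ := by gcongr

/-! ### Convergence for clustered data and the main theorem -/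

section Data

variable {n d k K Kbar : ℕ} {clow cup ρ δ Γ η : ℝ} {φ : ℝ → ℝ} {v : Fin k → ℝ}

/-- Convergence of gradient descent from a well-conditioned initialization. -/
theorem CorruptedDataset.gdIterate_converges (D : CorruptedDataset n d K Kbar clow cup ρ 0 δ)
    (hlow : 0 < clow) (hup : clow < cup) (hn : 0 < n) (hK : 2 ≤ K) (hk : 0 < k) (hΓ : 1 ≤ Γ)
    (hφ : IsBoundedActivation φ Γ) (hv : ∀ j, v j ^ 2 ≤ 1 / k) (hv1 : ∑ j, v j ^ 2 ≤ 1)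
    (hlam : 0 < minEigCov φ D.centerMatrix) (hη : 0 < η)
    (hη' : η ≤ K / (2 * cup * n * Γ ^ 2 * specNorm D.centerMatrix ^ 2))
    (hwidth : 135424 * (cup / clow ^ 2) * Γ ^ 4 * (K * Real.log K * specNorm D.centerMatrix ^ 2
          / minEigCov φ D.centerMatrix ^ 2) ≤ k) (W₀ : Weights k d)
    (hnet : ∀ l, |network φ v W₀ (D.center l)| ≤ 21 * Γ * Real.sqrt (Real.log K))
    (hgrad : ∀ r : EuclideanSpace ℝ (Fin K),
      minEigCov φ D.centerMatrix / 2 * ∑ l, (D.clusterWeight l * r l) ^ 2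
        ≤ ‖weightedGrad φ v D.clusterWeight D.center W₀ r‖ ^ 2) (τ : ℕ) :
    η * (minEigCov φ D.centerMatrix * clow * n / (2 * K)) / 8 ≤ 1 ∧
    ‖gdIterate φ v D.x D.y η W₀ τ - W₀‖
        ≤ 131 / Real.sqrt clow * Γ * Real.sqrt (K * Real.log K / minEigCov φ D.centerMatrix) ∧
      ‖weightedNet φ v D.clusterWeight D.center (gdIterate φ v D.x D.y η W₀ τ) - D.weightedLabel‖
        ≤ (1 - η * (minEigCov φ D.centerMatrix * clow * n / (2 * K)) / 8) ^ τ
          * (23 * Γ * Real.sqrt (n * Real.log K)) := by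
  set lam := minEigCov φ D.centerMatrix with hlamdef
  set S := specNorm D.centerMatrix with hS
  have hcup : 0 < cup := hlow.trans hup
  have hnR : (0 : ℝ) < n := by exact_mod_cast hn
  have hK2 : (2 : ℝ) ≤ K := by exact_mod_cast hK
  have hKR : (0 : ℝ) < K := by linarith
  have hkR : (0 : ℝ) < k := by exact_mod_cast hk
  have hlog2 : Real.log 2 ≤ Real.log K := Real.log_le_log (by norm_num) hK2
  have hlog : 0.69 ≤ Real.log K := by linarith [Real.log_two_gt_d9]
  have hΓ0 : 0 < Γ := by linarith
  let l₀ : Fin K := ⟨0, by omega⟩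
  have hsize : ∀ l, 1 ≤ D.clusterSize l := D.one_le_clusterSize hlow hn (by omega)
  have hC1 := D.sum_sq_centerMatrix
  have hS1 : 1 ≤ S := one_le_specNorm _ hC1 l₀
  have hS0 : 0 < S := by linarith
  set N : ℝ := cup * (n / K) with hN
  have hN0 : 0 < N := by positivity
  have hsN : ∀ l, D.clusterWeight l ^ 2 ≤ N := fun l => by
    rw [D.clusterWeight_sq]
    exact D.balanced_up l
  set β := Real.sqrt N * Γ * S with hβ
  set L := Real.sqrt N * Γ * S * (1 / Real.sqrt k) with hL
  set R := 23 * Γ * Real.sqrt (n * Real.log K) with hR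
  set a := Real.sqrt (lam * clow * n / (2 * K)) with ha
  have ha2 : a ^ 2 = lam * clow * n / (2 * K) := Real.sq_sqrt (by positivity)
  have ha0 : 0 < a := Real.sqrt_pos.2 (by positivity)
  have hR2 : R ^ 2 = 529 * Γ ^ 2 * (n * Real.log K) := by
    rw [hR, mul_pow, mul_pow, Real.sq_sqrt (by positivity)]; norm_num
  have hβ2 : β ^ 2 = N * Γ ^ 2 * S ^ 2 := by
    rw [hβ, mul_pow, mul_pow, Real.sq_sqrt hN0.le]
  have hL2 : L ^ 2 = N * Γ ^ 2 * S ^ 2 / k := by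
    rw [hL, mul_pow, ← hβ, hβ2, div_pow, Real.sq_sqrt hkR.le]; ring
  have hGβ : ∀ W : Weights k d, ‖weightedGrad φ v D.clusterWeight D.center W‖ ≤ β :=
    norm_weightedGrad_le v D.clusterWeight D.center hΓ0.le hN0.le hφ.deriv_le hv1 hsN
  have hGL : ∀ W W' : Weights k d, ‖weightedGrad φ v D.clusterWeight D.center W
      - weightedGrad φ v D.clusterWeight D.center W'‖ ≤ L * ‖W - W'‖ :=
    norm_weightedGrad_sub_le v D.clusterWeight D.center hΓ0.le hN0.le (by positivity)
      hφ.differentiable_deriv hφ.deriv_deriv_le (fun j => by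
        rw [div_pow, Real.sq_sqrt hkR.le, one_pow]; exact hv j) hsN D.norm_center
  have hlow' : ∀ r, a * ‖r‖ ≤ ‖weightedGrad φ v D.clusterWeight D.center W₀ r‖ := fun r => by
    refine abs_le_of_sq_le_sq' ?_ (norm_nonneg _) |>.2
    refine le_trans ?_ (hgrad r)
    rw [mul_pow, ha2, EuclideanSpace.real_norm_sq_eq]
    have h1 : clow * (n / K) * ∑ l, r l ^ 2 ≤ ∑ l, (D.clusterWeight l * r l) ^ 2 := by
      rw [Finset.mul_sum]
      refine Finset.sum_le_sum fun l _ => ?_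
      rw [mul_pow, D.clusterWeight_sq]
      gcongr
      exact D.balanced_low l
    calc _ = lam / 2 * (clow * (n / K) * ∑ l, r l ^ 2) := by field_simp
      _ ≤ _ := by gcongr
  -- The lower and upper bounds are compared on one unit vector.
  have haβ : a ≤ β := by
    have h1 := (hlow' (EuclideanSpace.single l₀ 1)).trans
      (ContinuousLinearMap.le_of_opNorm_le _ (hGβ W₀) _)
    simpa using h1
  have hηβ : η * β ^ 2 ≤ 1 / 2 := by
    rw [hβ2]
    calc η * (N * Γ ^ 2 * S ^ 2)
        ≤ K / (2 * cup * n * Γ ^ 2 * S ^ 2) * (N * Γ ^ 2 * S ^ 2) := by gcongr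
      _ = 1 / 2 := by rw [hN]; field_simp
  -- After squaring, this is the width condition: `135424 = 8² * 23² * 2²`.
  have hsmall : 8 * L * R ≤ a ^ 2 := by
    refine abs_le_of_sq_le_sq' ?_ (by positivity) |>.2
    rw [mul_pow, mul_pow, hL2, hR2, ha2]
    calc (8 : ℝ) ^ 2 * (N * Γ ^ 2 * S ^ 2 / k) * (529 * Γ ^ 2 * (n * Real.log K))
        = (135424 * (cup / clow ^ 2) * Γ ^ 4 * (K * Real.log K * S ^ 2 / lam ^ 2)) / k *
          (lam * clow * n / (2 * K)) ^ 2 := by rw [hN]; field_simp; ring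
      _ ≤ 1 * (lam * clow * n / (2 * K)) ^ 2 := by
          gcongr
          rwa [div_le_one hkR]
      _ = _ := one_mul _
  -- The 23 in `R` is 21 for the initial output plus 2 for the mean label, since `1 ≤ 2 Γ √(log K)`.
  -- The cluster sizes add up to `n`.
  have hres : ‖weightedNet φ v D.clusterWeight D.center W₀ - D.weightedLabel‖ ≤ R := by
    refine abs_le_of_sq_le_sq' ?_ (by positivity) |>.2
    rw [hR2, EuclideanSpace.real_norm_sq_eq]
    have h1 : ∀ l, (weightedNet φ v D.clusterWeight D.center W₀ - D.weightedLabel) l ^ 2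
        ≤ D.clusterSize l * (529 * Γ ^ 2 * Real.log K) := fun l => by
      rw [D.weightedNet_sub_apply, mul_pow, D.clusterWeight_sq]
      gcongr
      have h3 : 1 ≤ 2 * Γ * Real.sqrt (Real.log K) := by
        have : 1 / 2 ≤ Real.sqrt (Real.log K) := Real.le_sqrt_of_sq_le (by linarith)
        nlinarith
      have h4 : |network φ v W₀ (D.center l) - D.meanLabel l|
          ≤ 23 * Γ * Real.sqrt (Real.log K) := by
        refine (abs_sub _ _).trans ?_
        linarith [hnet l, D.abs_meanLabel_le (hsize l)]
      have h5 := pow_le_pow_left₀ (abs_nonneg _) h4 2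
      rw [sq_abs, mul_pow, mul_pow, Real.sq_sqrt (by linarith)] at h5
      linarith
    calc _ ≤ ∑ l, (D.clusterSize l : ℝ) * (529 * Γ ^ 2 * Real.log K) :=
          Finset.sum_le_sum fun l _ => h1 l
      _ = 529 * Γ ^ 2 * (n * Real.log K) := by
          rw [← Finset.sum_mul, ← Nat.cast_sum, D.sum_clusterSize]; ring
  have hmain := gradientDescent_converges (F := weightedNet φ v D.clusterWeight D.center)
    (G := weightedGrad φ v D.clusterWeight D.center) (by positivity : 0 ≤ L) hη.le ha0 haβ
    (hasFDerivAt_weightedNet v D.clusterWeight D.center hφ.differentiable) hGL hGβ hηβ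
    D.weightedLabel (gdIterate φ v D.x D.y η W₀) (fun τ => by
      rw [gdIterate, D.gradient_loss hφ.differentiable v hsize])
    hlow' hres hsmall τ
  rw [ha2] at hmain
  have hηa : η * a ^ 2 ≤ 1 / 2 := le_trans (by gcongr) hηβ
  rw [ha2] at hηa
  refine ⟨by linarith, hmain.1.trans ?_, hmain.2⟩
  refine abs_le_of_sq_le_sq' ?_ (by positivity) |>.2
  rw [div_pow, mul_pow, hR2, ha2, mul_pow, mul_pow, div_pow, Real.sq_sqrt hlow.le,
    Real.sq_sqrt (by positivity)]
  -- `16928 = 16 * 529 * 2`, and 131 is its square root rounded up.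
  calc (4 : ℝ) ^ 2 * (529 * Γ ^ 2 * (n * Real.log K)) / (lam * clow * n / (2 * K))
      = 16928 * (Γ ^ 2 * K * Real.log K / (clow * lam)) := by field_simp; norm_num
    _ ≤ 131 ^ 2 * (Γ ^ 2 * K * Real.log K / (clow * lam)) := by gcongr; norm_num
    _ = _ := by field_simp

/-- If the weighted residual is small, the network predicts the ground truth. -/
theorem CorruptedDataset.abs_network_sub_truth_le
    (D : CorruptedDataset n d K Kbar clow cup ρ 0 δ) (hsize : ∀ l, 1 ≤ D.clusterSize l)
    (W : Weights k d)
    (hres : ‖weightedNet φ v D.clusterWeight D.center W - D.weightedLabel‖ ≤ ρ) (i : Fin n) :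
    |network φ v W (D.x i) - D.truth i| ≤ 3 * ρ := by
  rw [D.x_eq i]
  set l := D.cluster i with hl
  have h2 := (PiLp.norm_apply_le (weightedNet φ v D.clusterWeight D.center W
    - D.weightedLabel) l).trans hres
  -- Clusters are nonempty, so the weighted residual dominates the unweighted one.
  have hw : 1 ≤ D.clusterWeight l := Real.one_le_sqrt.2 (by exact_mod_cast hsize l)
  rw [D.weightedNet_sub_apply, norm_mul, Real.norm_eq_abs, Real.norm_eq_abs,
    abs_of_pos (by linarith)] at h2
  have h3 : |network φ v W (D.center l) - D.meanLabel l| ≤ ρ :=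
    (le_mul_of_one_le_left (abs_nonneg _) hw).trans h2
  have h4 : |D.meanLabel l - D.truth i| ≤ 2 * ρ := D.abs_meanLabel_sub_le (hsize l)
  have h5 := abs_sub_le (network φ v W (D.center l)) (D.meanLabel l) (D.truth i)
  linarith

end Data

theorem mainTheorem2 (clow cup : ℝ) (hlow : 0 < clow) (hup : clow < cup) :
    ∃ C c : ℝ, 0 < C ∧ 0 < c ∧
      ∀ (n d k K Kbar : ℕ) (δ ρ Γ η : ℝ) (φ : ℝ → ℝ) (v : Fin k → ℝ)
        (D : CorruptedDataset n d K Kbar clow cup ρ 0 δ),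
        0 < n → 0 < K → 0 < δ → 0 < ρ → ρ ≤ 1 → 1 ≤ Γ →
        IsBoundedActivation φ Γ → IsBalancedOutput v →
        0 < minEigCov φ D.centerMatrix →
        0 < η → η ≤ K / (2 * cup * n * Γ ^ 2 * specNorm D.centerMatrix ^ 2) →
        C * Γ ^ 4 * (K * Real.log K * specNorm D.centerMatrix ^ 2
          / minEigCov φ D.centerMatrix ^ 2) ≤ k →
        1 - 2 / (K : ℝ) ^ 100 ≤ (stdNormal (Fin k × Fin d)).real
          {W₀ : Weights k d |
            (∀ τ : ℕ, ‖gdIterate φ v D.x D.y η W₀ τ - W₀‖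
              ≤ c * Γ * Real.sqrt (K * Real.log K / minEigCov φ D.centerMatrix)) ∧
            (∀ τ : ℕ, c * (K / (η * n * minEigCov φ D.centerMatrix))
                * Real.log (Γ * Real.sqrt (n * Real.log K) / ρ) ≤ τ →
              (∀ i, |network φ v (gdIterate φ v D.x D.y η W₀ τ) (D.x i) - D.truth i| ≤ 4 * ρ) ∧
              (ρ ≤ δ / 8 → ∀ i,
                argminLabel D.α (network φ v (gdIterate φ v D.x D.y η W₀ τ) (D.x i))
                  = {D.truth i}))} := by
  have hcup : 0 < cup := hlow.trans hup
  -- The summands of `C` serve the concentration and the smallness condition; those of `c` serve the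
  -- distance and the time, with `400 = 25 * 16` for 25 logarithms at rate `η λ clow n / (16 K)`.
  refine ⟨7416 + 135424 * (cup / clow ^ 2), 131 / Real.sqrt clow + 400 / clow, by positivity,
    by positivity, ?_⟩
  intro n d k K Kbar δ ρ Γ η φ v D hn hK0 hδ hρ hρ1 hΓ hφ hv hlam hη hη' hwidth
  -- For `K = 1` the claimed probability is negative.
  rcases (show K = 1 ∨ 2 ≤ K by omega) with rfl | hK
  · refine le_trans ?_ measureReal_nonneg
    norm_num
  set lam := minEigCov φ D.centerMatrix with hlamdef
  set S := specNorm D.centerMatrix with hS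
  have hK2 : (2 : ℝ) ≤ K := by exact_mod_cast hK
  have hKR : (0 : ℝ) < K := by linarith
  have hnR : (0 : ℝ) < n := by exact_mod_cast hn
  have hlog2 : Real.log 2 ≤ Real.log K := Real.log_le_log (by norm_num) hK2
  have hlog : 0.69 ≤ Real.log K := by linarith [Real.log_two_gt_d9]
  have hΓ0 : 0 < Γ := by linarith
  let l₀ : Fin K := ⟨0, by omega⟩
  have hsize : ∀ l, 1 ≤ D.clusterSize l := D.one_le_clusterSize hlow hn hK0
  have hC1 := D.sum_sq_centerMatrix
  have hS1 : 1 ≤ S := one_le_specNorm _ hC1 l₀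
  have hS0 : 0 < S := by linarith
  have hlamΓ : lam ≤ Γ ^ 2 := minEigCov_le hφ.deriv_le _ hC1 l₀
  set Q := K * Real.log K * S ^ 2 / lam ^ 2 with hQ
  have hQ0 : 0 < Q := by positivity
  have hcw : 0 < cup / clow ^ 2 := by positivity
  have hwidth1 : 7416 * (Γ ^ 4 * Q) ≤ k := by
    have : 0 ≤ 135424 * (cup / clow ^ 2) * (Γ ^ 4 * Q) := by positivity
    linarith
  have hwidth2 : 135424 * (cup / clow ^ 2) * Γ ^ 4 * Q ≤ k := by
    have : 0 ≤ Γ ^ 4 * Q := by positivity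
    linarith
  have hΓQ : 1 ≤ Γ ^ 4 * Q := one_le_width_factor hK hS1 hlam hlamΓ
  have hk2 : 2 ≤ k := by
    have : (2 : ℝ) ≤ k := by linarith
    exact_mod_cast this
  have hk : 0 < k := by omega
  set t := lam / (6 * (S * Real.sqrt K)) with ht
  have htS : t * (S * Real.sqrt K) = lam / 6 := by
    have : 0 < Real.sqrt K := Real.sqrt_pos.2 hKR
    rw [ht]; field_simp
  have htk : 103 * Real.log K ≤ t ^ 2 * k / (2 * Γ ^ 4) :=
    log_le_of_width hK0 hS0 hΓ0 hlam hwidth1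
  refine (le_measure_initialization D.center D.norm_center hΓ0 hk hK hφ.differentiable
    hφ.deriv_le hφ.differentiable_deriv hv.sq_le (hv.sum_sq_le_one hk) (hv.sum_eq_zero hk)
    (by positivity) htk).trans (measureReal_mono ?_)
  rintro W₀ ⟨hcov, hnet⟩
  have hconv := D.gdIterate_converges hlow hup hn hK hk hΓ hφ hv.sq_le (hv.sum_sq_le_one hk)
    hlam hη hη' hwidth2 W₀ hnet (fun r => by
      have h := le_norm_weightedGrad_sq v D.clusterWeight D.center D.norm_center W₀
        (hv.le_sum_sq hk2) hlam.le hcov r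
      refine le_of_eq_of_le ?_ h
      change _ = (2 / 3 * lam - t * (S * Real.sqrt K)) * _
      -- `2/3 - 1/6 = 1/2`: mass of `v` minus the fluctuation allowed by the choice of `t`.
      rw [htS]; ring)
  refine ⟨fun τ => (hconv τ).2.1.trans ?_, fun τ hτ => ?_⟩
  · have : 0 ≤ 400 / clow := by positivity
    gcongr
    linarith
  have hn2 : 2 ≤ n := hK.trans (D.card_clusters_le hsize)
  set X := Γ * Real.sqrt (n * Real.log K) / ρ with hX
  obtain ⟨hX0, hX2⟩ := le_sq_log_argument hn2 hK hΓ hρ hρ1 hX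
  have hlogX : 0 ≤ Real.log X := Real.log_nonneg (by nlinarith)
  have hτ' : 25 * Real.log X ≤ η * (lam * clow * n / (2 * K)) / 8 * τ := by
    calc 25 * Real.log X
        = η * (lam * clow * n / (2 * K)) / 8 *
          (400 / clow * (K / (η * n * lam)) * Real.log X) := by field_simp; ring
      _ ≤ η * (lam * clow * n / (2 * K)) / 8 * τ := by
        gcongr
        refine le_trans ?_ hτ
        gcongr
        have : 0 ≤ 131 / Real.sqrt clow := by positivity
        linarith
  have hres := (hconv τ).2.2.trans (pow_mul_le_of_log_le (hconv τ).1 hρ hX2 hX0 τ hτ' (by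
    rw [hX]; field_simp))
  set W := gdIterate φ v D.x D.y η W₀ τ with hW
  have hfit : ∀ i, |network φ v W (D.x i) - D.truth i| ≤ 3 * ρ :=
    fun i => D.abs_network_sub_truth_le hsize W hres i
  refine ⟨fun i => (hfit i).trans (by linarith), fun hρδ i => ?_⟩
  -- The error `3ρ ≤ 3δ/8` is strictly below half the separation.
  exact argminLabel_eq_singleton D.label_sep _ ((hfit i).trans_lt (by linarith))
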